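/- **Setting.** Let $(\Omega,\mathcal F,P)$ be a probability space, $\mathcal X$ a measurable space, $n\ge 1$, and let $(X_i,Y_i)$, $i=1,\dots,n$, be i.i.d. with $X_i\in\mathcal X$ and $Y_i\in\{0,1\}$. Let $\mathbf F$ be a real vector space of measurable functions $f:\mathcal X\to\mathbb R$ with $Ef(X_1)^2<\infty$; write $\|f\|=(Ef(X_1)^2)^{1/2}$ and $\|f\|_\infty=\sup_{x\in\mathcal X}|f(x)|$. Let $\pi(x)=P(Y_1=1\mid X_1=x)$ and suppose that the logit model holds in $\mathbf F$: $\pi=e^{g}/(1+e^{g})$ on $\mathcal X$ for some $g\in\mathbf F$. Consider the logistic loss $\rho_f(x,y)=-yf(x)+\log(1+e^{f(x)})$ with $P_n\rho_f=\frac1n\sum_{i=1}^n\rho_f(X_i,Y_i)$ and $P\rho_f=\frac1n\sum_{i=1}^nE\rho_f(X_i,Y_i)$. Let the target $f^0$ be a minimizer of $P\rho_f$ over $f\in\mathbf F$, and let $\Xi(f)=P\rho_f-P\rho_{f^0}$. For $\eta>0$ let $\mathbf F_{\rm local}=\{f\in\mathbf F:\|f-f^0\|_\infty\le\eta\}$.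 Let $\psi_1,\dots,\psi_p\in\mathbf F$, $\psi=(\psi_1,\dots,\psi_p)'$ and $f_\beta=\sum_{j=1}^p\beta_j\psi_j$. Let $\Phi\subseteq\mathbb R^p$ be convex (for instance $\Phi=\mathbb R^p$). For $\lambda_1,\lambda_2>0$ let the elastic net $\hat\beta$ be a minimizer of $P_n\rho_{f_\beta}+\lambda_1\|\beta\|_1+\lambda_2\|\beta\|_2^2$ over $\beta\in\Phi$, and let $\hat f=f_{\hat\beta}$. For $S\subseteq\{1,\dots,p\}$ let $\beta_S$ be the vector that agrees with $\beta$ on $S$ and is $0$ elsewhere; let $S_\beta=\{j:\beta_j\ne0\}$ and $s_\beta=|S_\beta|$. Let $\phi(S_\beta)\ge 0$ be defined by $$\phi^2(S_\beta)=\inf\Big\{\frac{\|f_b\|^2}{\|b_{S_\beta}\|_2^2}: b\in\mathbb R^p\setminus\{0\},\ \|b_{S_\beta^c}\|_1\le 3\Big(\sqrt{s_\beta}+\frac{2\lambda_2\|\beta\|_2}{\lambda_1}\Big)\|b_{S_\beta}\|_2\Big\}.$$ Let $0<\epsilon_0\le\frac12$, $c=\dfrac{\epsilon_0e^{-\eta}}{2(1+e^\eta/\epsilon_0)^2}$,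 $G(u)=cu^2$ and $H(v)=\sup_{u\ge0}\{uv-G(u)\}$. For a collection $\Gamma$ of subsets of $\{1,\dots,p\}$ let the oracle $\beta^*$ be a minimizer of $$3\,\Xi(f_\beta)+2H\Big(\frac{4\lambda_1\sqrt{s_\beta}+4\lambda_2\|\beta\|_2}{\phi(S_\beta)}\Big)$$ over all $\beta\in\mathbb R^p$ with $S_\beta\in\Gamma$. Assume $\beta^*\in\Phi$ and $\beta^*\neq0$. Let $f^*=f_{\beta^*}$, $S^*=S_{\beta^*}$, $s^*=|S^*|$, $\phi_*=\phi(S^*)$, and let $2\Delta^*$ be the minimal value. For $\lambda_0>0$ let $M^*=\Delta^*/\lambda_0$, and with $V_n(\beta)=\frac1n\sum_{i=1}^n[\rho_{f_\beta}(X_i,Y_i)-E\rho_{f_\beta}(X_i,Y_i)]$ let $$\tau=\Big\{\sup_{\|\beta-\beta^*\|_1\le M^*}|V_n(\beta)-V_n(\beta^*)|\le\lambda_0M^*\Big\}.$$ **Assumptions.** Suppose that $\epsilon_0\le\pi(x)\le1-\epsilon_0$ for all $x\in\mathcal X$ and that $\max_{1\le j\le p}\|\psi_j\|_\infty\le K$,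 where $K>0$. Suppose that $8\lambda_0\le\lambda_1\le L\lambda_0$ for some constant $L\ge8$, that $\lambda_2=\dfrac{\lambda_1\sqrt{s^*}}{2\|\beta^*\|_2}$, and that $$\frac{36L^2\lambda_0s^*K}{\eta\,\phi_*^2\,c}\le1,\qquad \|f^*-f^0\|_\infty\le\frac\eta2,\qquad \frac32\,\Xi(f^*)\le\frac{9\lambda_1^2s^*}{\phi_*^2c}.$$ Finally, suppose that the $p\times p$ matrix $\Sigma=E(\psi(X_1)\psi(X_1)')$ has full rank. **Conclusion.** Then: (a) The margin condition holds with the quadratic margin $G$, that is, $\Xi(f)\ge c\|f-f^0\|^2$ for all $f\in\mathbf F_{\rm local}$ (Assumption 1); $f^*\in\mathbf F_{\rm local}$, and $f_\beta\in\mathbf F_{\rm local}$ for all $\beta$ with $\|\beta-\beta^*\|_1\le M^*$ (Assumption 2); $\phi_*>0$ (Assumption 3); and on the event $\tau$ $$\Xi(\hat f)+\lambda_1\|\hat\beta-\beta^*\|_1+\lambda_2\|\hat\beta_{S^*}-\beta^*_{S^*}\|_2^2\le6\,\Xi(f^*)+\frac{36\lambda_1^2s^*}{\phi_*^2c}.\qquad(*)$$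 (b) There is a constant $d>0$, depending only on $K$, such that the following holds. If, in addition, $p\ge2$, $\log p\le n$, $\frac1n\sum_{i=1}^n\max_{1\le j\le p}E\psi_j^2(X_i)\le1$ and $\lambda_0=2d\sqrt{\log(p)/n}$, then $P(\tau)\ge1-\frac1p$, and $(*)$ holds with probability at least $1-\frac1p$. -/

import Mathlib

open MeasureTheory ProbabilityTheory

noncomputable section

namespace LogitNet

/-! ### Vectors of coefficients -/

/-- The `ℓ₁`-norm `‖v‖₁ = ∑ⱼ |vⱼ|`. -/
def l1 {p : ℕ} (v : Fin p → ℝ) : ℝ := ∑ j, |v j|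

/-- The `ℓ₂`-norm `‖v‖₂ = (∑ⱼ vⱼ²)^(1/2)`. -/
def l2 {p : ℕ} (v : Fin p → ℝ) : ℝ := Real.sqrt (∑ j, v j ^ 2)

/-- The vector `v_S`, which agrees with `v` on `S` and vanishes off `S`. -/
def restr {p : ℕ} (S : Finset (Fin p)) (v : Fin p → ℝ) : Fin p → ℝ :=
  fun j => if j ∈ S then v j else 0

/-- The set `S_β` of the indices of the non-zero coefficients of `β`. -/
def supp {p : ℕ} (β : Fin p → ℝ) : Finset (Fin p) := Finset.univ.filter fun j => β j ≠ 0

/-- The linear combination `f_β = ∑ⱼ βⱼ ψⱼ` of the basis functions. -/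
def linComb {𝒳 : Type*} {p : ℕ} (ψ : Fin p → 𝒳 → ℝ) (β : Fin p → ℝ) : 𝒳 → ℝ :=
  fun x => ∑ j, β j * ψ j x

/-! ### Loss, risk, target, elastic net -/

/-- The logistic loss `ρ_f(x, y) = - y f(x) + log (1 + exp (f x))`. -/
def logitLoss {𝒳 : Type*} (f : 𝒳 → ℝ) (x : 𝒳) (y : ℝ) : ℝ :=
  -y * f x + Real.log (1 + Real.exp (f x))

/-- The empirical risk `Pₙ ρ_f` at the outcome `ω`. -/
def empRisk {Ω 𝒳 : Type*} {n : ℕ} (X : Fin n → Ω → 𝒳) (Y : Fin n → Ω → ℝ)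
    (f : 𝒳 → ℝ) (ω : Ω) : ℝ :=
  (1 / (n : ℝ)) * ∑ i, logitLoss f (X i ω) (Y i ω)

/-- The population risk `P ρ_f = (1/n) ∑ᵢ E ρ_f(Xᵢ, Yᵢ)`. -/
def risk {Ω 𝒳 : Type*} [MeasurableSpace Ω] (P : Measure Ω) {n : ℕ}
    (X : Fin n → Ω → 𝒳) (Y : Fin n → Ω → ℝ) (f : 𝒳 → ℝ) : ℝ :=
  (1 / (n : ℝ)) * ∑ i, ∫ ω, logitLoss f (X i ω) (Y i ω) ∂P

/-- `f⁰` is a target: a minimizer of the population risk over the function space `F`. -/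
def IsTarget {Ω 𝒳 : Type*} [MeasurableSpace Ω] (P : Measure Ω) {n : ℕ}
    (X : Fin n → Ω → 𝒳) (Y : Fin n → Ω → ℝ) (F : Submodule ℝ (𝒳 → ℝ)) (f0 : 𝒳 → ℝ) : Prop :=
  f0 ∈ F ∧ ∀ f ∈ F, risk P X Y f0 ≤ risk P X Y f

/-- The excess risk `Ξ(f) = P ρ_f - P ρ_{f⁰}`. -/
def excessRisk {Ω 𝒳 : Type*} [MeasurableSpace Ω] (P : Measure Ω) {n : ℕ}
    (X : Fin n → Ω → 𝒳) (Y : Fin n → Ω → ℝ) (f0 f : 𝒳 → ℝ) : ℝ :=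
  risk P X Y f - risk P X Y f0

/-- `b` minimizes the empirical risk plus the elastic net penalty over `Φ`, at the outcome `ω`. -/
def IsElasticNet {Ω 𝒳 : Type*} {n p : ℕ} (X : Fin n → Ω → 𝒳) (Y : Fin n → Ω → ℝ)
    (ψ : Fin p → 𝒳 → ℝ) (Φ : Set (Fin p → ℝ)) (lam1 lam2 : ℝ) (ω : Ω) (b : Fin p → ℝ) : Prop :=
  b ∈ Φ ∧ ∀ β ∈ Φ,
    empRisk X Y (linComb ψ b) ω + lam1 * l1 b + lam2 * l2 b ^ 2 ≤
      empRisk X Y (linComb ψ β) ω + lam1 * l1 β + lam2 * l2 β ^ 2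

/-! ### Margin condition and convex conjugate -/

/-- The `L₂(P)`-norm `(E f(X)²)^(1/2)` of a function `f` of the covariate `X`. -/
def L2norm {Ω 𝒳 : Type*} [MeasurableSpace Ω] (P : Measure Ω) (X : Ω → 𝒳) (f : 𝒳 → ℝ) : ℝ :=
  Real.sqrt (∫ ω, f (X ω) ^ 2 ∂P)

/-- `‖f‖_∞ ≤ r` for the supremum norm over all of `𝒳`. -/
def SupNormLE {𝒳 : Type*} (f : 𝒳 → ℝ) (r : ℝ) : Prop := ∀ x, |f x| ≤ r

/-- The neighbourhood `F_local = {f ∈ F : ‖f - f⁰‖_∞ ≤ η}` of the target. -/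
def Flocal {𝒳 : Type*} (F : Submodule ℝ (𝒳 → ℝ)) (f0 : 𝒳 → ℝ) (η : ℝ) : Set (𝒳 → ℝ) :=
  {f | f ∈ F ∧ SupNormLE (f - f0) η}

/-- The margin condition with margin function `G` (strictly convex on `[0, ∞)`, `G 0 = 0`),
for an excess risk `Ξ`, a norm `nrm` and the local set `Floc`. -/
def MarginCondition {𝒳 : Type*} (Floc : Set (𝒳 → ℝ)) (Ξ nrm : (𝒳 → ℝ) → ℝ) (f0 : 𝒳 → ℝ)
    (G : ℝ → ℝ) : Prop :=
  StrictConvexOn ℝ (Set.Ici 0) G ∧ G 0 = 0 ∧ ∀ f ∈ Floc, G (nrm (f - f0)) ≤ Ξ f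

/-- The convex conjugate `H(v) = sup_{u ≥ 0} (u v - G u)`. -/
def convConj (G : ℝ → ℝ) (v : ℝ) : ℝ := sSup ((fun u => u * v - G u) '' Set.Ici 0)

/-- The constant `c = ε₀ e^{-η} / (2 (1 + e^η / ε₀)²)`. -/
def marginConst (ε0 η : ℝ) : ℝ :=
  ε0 * Real.exp (-η) / (2 * (1 + Real.exp η / ε0) ^ 2)

/-- The quadratic margin function `G(u) = c u²`. -/
def quadMargin (c : ℝ) : ℝ → ℝ := fun u => c * u ^ 2

/-! ### Adaptive restricted eigenvalue, oracle -/

/-- The population matrix `Σ = E ψ(X) ψ(X)'`. -/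
def gram {Ω 𝒳 : Type*} [MeasurableSpace Ω] (P : Measure Ω) (X : Ω → 𝒳) {p : ℕ}
    (ψ : Fin p → 𝒳 → ℝ) : Matrix (Fin p) (Fin p) ℝ :=
  Matrix.of fun j k => ∫ ω, ψ j (X ω) * ψ k (X ω) ∂P

/-- The constant `L_n = 3 (√|S| + 2 λ₂ ‖β_S‖₂ / λ₁)`. -/
def coneConst {p : ℕ} (lam1 lam2 : ℝ) (S : Finset (Fin p)) (β : Fin p → ℝ) : ℝ :=
  3 * (Real.sqrt S.card + 2 * lam2 * l2 (restr S β) / lam1)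

/-- The adaptive restricted eigenvalue `φ(S_β)`: the root of the infimum of `‖f_b‖² / ‖b_S‖₂²`
over all `b ≠ 0` with `‖b_{Sᶜ}‖₁ ≤ L_n ‖b_S‖₂`, where `S = S_β`
and `L_n = 3 (√|S| + 2 λ₂ ‖β_S‖₂ / λ₁)` is computed from the given vector `β`. -/
def phi {Ω 𝒳 : Type*} [MeasurableSpace Ω] (P : Measure Ω) (X : Ω → 𝒳) {p : ℕ}
    (ψ : Fin p → 𝒳 → ℝ) (lam1 lam2 : ℝ) (β : Fin p → ℝ) : ℝ :=
  Real.sqrt (sInf {r : ℝ | ∃ b : Fin p → ℝ, b ≠ 0 ∧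
    l1 (restr (supp β)ᶜ b) ≤ coneConst lam1 lam2 (supp β) β * l2 (restr (supp β) b) ∧
    r = L2norm P X (linComb ψ b) ^ 2 / l2 (restr (supp β) b) ^ 2})

/-- The criterion
`3 Ξ(f_β) + 2 H ((4 λ₁ √s_β + 4 λ₂ ‖β‖₂) / φ(S_β))` that is minimized by the oracle. -/
def oracleObj {Ω 𝒳 : Type*} [MeasurableSpace Ω] (P : Measure Ω) {n p : ℕ} [NeZero n]
    (X : Fin n → Ω → 𝒳) (Y : Fin n → Ω → ℝ) (ψ : Fin p → 𝒳 → ℝ) (f0 : 𝒳 → ℝ)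
    (G : ℝ → ℝ) (lam1 lam2 : ℝ) (β : Fin p → ℝ) : ℝ :=
  3 * excessRisk P X Y f0 (linComb ψ β) +
    2 * convConj G ((4 * lam1 * Real.sqrt (supp β).card + 4 * lam2 * l2 β) /
      phi P (X 0) ψ lam1 lam2 β)

/-- `βs` is an oracle: it minimizes `oracleObj` over all `β ∈ ℝᵖ` with `S_β ∈ Γ`. -/
def IsOracle {Ω 𝒳 : Type*} [MeasurableSpace Ω] (P : Measure Ω) {n p : ℕ} [NeZero n]
    (X : Fin n → Ω → 𝒳) (Y : Fin n → Ω → ℝ) (ψ : Fin p → 𝒳 → ℝ) (f0 : 𝒳 → ℝ)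
    (G : ℝ → ℝ) (lam1 lam2 : ℝ) (Γ : Set (Finset (Fin p))) (βs : Fin p → ℝ) : Prop :=
  supp βs ∈ Γ ∧ ∀ β : Fin p → ℝ, supp β ∈ Γ →
    oracleObj P X Y ψ f0 G lam1 lam2 βs ≤ oracleObj P X Y ψ f0 G lam1 lam2 β

/-- `M* = Δ* / λ₀`, where `2 Δ*` is the value of the oracle criterion at the oracle `βs`. -/
def Mstar {Ω 𝒳 : Type*} [MeasurableSpace Ω] (P : Measure Ω) {n p : ℕ} [NeZero n]
    (X : Fin n → Ω → 𝒳) (Y : Fin n → Ω → ℝ) (ψ : Fin p → 𝒳 → ℝ) (f0 : 𝒳 → ℝ)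
    (G : ℝ → ℝ) (lam0 lam1 lam2 : ℝ) (βs : Fin p → ℝ) : ℝ :=
  (oracleObj P X Y ψ f0 G lam1 lam2 βs / 2) / lam0

/-! ### The empirical process and the event `τ` -/

/-- The empirical process `Vₙ(β) = (1/n) ∑ᵢ (ρ_{f_β}(Zᵢ) - E ρ_{f_β}(Zᵢ))`. -/
def Vn {Ω 𝒳 : Type*} [MeasurableSpace Ω] (P : Measure Ω) {n p : ℕ}
    (X : Fin n → Ω → 𝒳) (Y : Fin n → Ω → ℝ) (ψ : Fin p → 𝒳 → ℝ)
    (β : Fin p → ℝ) (ω : Ω) : ℝ :=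
  (1 / (n : ℝ)) * ∑ i, (logitLoss (linComb ψ β) (X i ω) (Y i ω) -
    ∫ ω', logitLoss (linComb ψ β) (X i ω') (Y i ω') ∂P)

/-- The local supremum `Z_M = sup {|Vₙ(β) - Vₙ(β*)| : ‖β - β*‖₁ ≤ M}`. -/
def ZM {Ω 𝒳 : Type*} [MeasurableSpace Ω] (P : Measure Ω) {n p : ℕ}
    (X : Fin n → Ω → 𝒳) (Y : Fin n → Ω → ℝ) (ψ : Fin p → 𝒳 → ℝ)
    (βs : Fin p → ℝ) (M : ℝ) (ω : Ω) : ℝ :=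
  sSup ((fun β => |Vn P X Y ψ β ω - Vn P X Y ψ βs ω|) '' {β | l1 (β - βs) ≤ M})

/-- The event `τ = {Z_{M*} ≤ λ₀ M*}`. -/
def tau {Ω 𝒳 : Type*} [MeasurableSpace Ω] (P : Measure Ω) {n p : ℕ} [NeZero n]
    (X : Fin n → Ω → 𝒳) (Y : Fin n → Ω → ℝ) (ψ : Fin p → 𝒳 → ℝ) (f0 : 𝒳 → ℝ)
    (G : ℝ → ℝ) (lam0 lam1 lam2 : ℝ) (βs : Fin p → ℝ) : Set Ω :=
  {ω | ZM P X Y ψ βs (Mstar P X Y ψ f0 G lam0 lam1 lam2 βs) ω ≤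
    lam0 * Mstar P X Y ψ f0 G lam0 lam1 lam2 βs}

/-- The oracle inequality
`Ξ(f̂) + λ₁ ‖β̂ - β*‖₁ + λ₂ ‖β̂_{S*} - β*_{S*}‖₂² ≤ 6 Ξ(f*) + 36 λ₁² s* / (φ*² c)`
for the value `b` of `β̂`. -/
def OracleIneq {Ω 𝒳 : Type*} [MeasurableSpace Ω] (P : Measure Ω) {n p : ℕ} [NeZero n]
    (X : Fin n → Ω → 𝒳) (Y : Fin n → Ω → ℝ) (ψ : Fin p → 𝒳 → ℝ) (f0 : 𝒳 → ℝ)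
    (c lam1 lam2 : ℝ) (βs b : Fin p → ℝ) : Prop :=
  excessRisk P X Y f0 (linComb ψ b) + lam1 * l1 (b - βs) +
      lam2 * l2 (restr (supp βs) b - restr (supp βs) βs) ^ 2 ≤
    6 * excessRisk P X Y f0 (linComb ψ βs) +
      36 * lam1 ^ 2 * ((supp βs).card : ℝ) / (phi P (X 0) ψ lam1 lam2 βs ^ 2 * c)

end LogitNet

end

/-! The proof has a deterministic half, which yields (a), and a probabilistic half, which bounds the
probability of `tau`.

Margin. Where `π = e^g / (1 + e^g)`, the conditional risk `u ↦ -π u + log (1 + e^u)` has a critical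
point at `g`, and its second derivative `e^u / (1 + e^u)²` is at least `2c` within `η` of `g`,
because `π` stays away from 0 and 1 (`quadratic_lower_bound`). Hence the target equals `g` almost
surely, and the excess risk dominates `c‖f - f⁰‖²` (`margin_of_logit`).

Oracle inequality. On `tau`, comparing the penalized empirical risks of estimator and oracle costs
at most `λ₀ M* = Δ*` in noise. The choice of `λ₂` makes the linear part of the ridge term equal to
`λ₁ √s*` times the `ℓ₂`-norm of the error on `S*`. Either this quantity is small against `Δ* +
Ξ(f*)`, or the error lies in the cone with constant `6√s*`; there `φ*` converts its `ℓ₂`-norm on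
`S*` into an `L₂(P)`-norm, and Young's inequality with the margin absorbs it (`oracle_arith`). The
outcome is `4Δ*`, the right side of the claim. Noise bound and margin hold only near the oracle, so
the argument is first run at a point of the segment from the oracle to the estimator; as `λ₁ ≥ 8λ₀`,
the bound obtained there forces the estimator itself into the ball of radius `M*`
(`oracleIneq_of_mem_tau`).

Probability. The exponential moment of the supremum over finitely many points of the `ℓ₁`-ball is
bounded by integrating out one observation at a time (`integral_expSup_pi_le`): symmetrization and
contraction replace the loss increment by a linear form, and a linear form on an `ℓ₁`-ball is
controlled by its coordinates, whence only a factor of order `p`. Chernoff's bound and a countable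
dense set finish (`tail_bound_finite`, `tail_bound_ZM`). -/

namespace LogitNet

/-! ### The function `u ↦ log (1 + exp u)` -/

theorem log_one_add_exp_sub_mem {u v : ℝ} (h : v ≤ u) :
    0 ≤ Real.log (1 + Real.exp u) - Real.log (1 + Real.exp v) ∧
      Real.log (1 + Real.exp u) - Real.log (1 + Real.exp v) ≤ u - v := by
  have hu := Real.exp_pos u
  have hv := Real.exp_pos v
  constructor
  · have : Real.log (1 + Real.exp v) ≤ Real.log (1 + Real.exp u) :=
      Real.log_le_log (by positivity) (by have := Real.exp_le_exp.2 h; linarith)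
    linarith
  · have h1 : 1 + Real.exp u ≤ Real.exp (u - v) * (1 + Real.exp v) := by
      have : Real.exp (u - v) * Real.exp v = Real.exp u := by rw [← Real.exp_add]; ring_nf
      have h2 : 1 ≤ Real.exp (u - v) := Real.one_le_exp (by linarith)
      nlinarith
    have h3 := Real.log_le_log (by positivity) h1
    rw [Real.log_mul (by positivity) (by positivity), Real.log_exp] at h3
    linarith

/-- The slope of the softplus term lies in `[0, 1]`; subtracting a response in `{0, 1}` leaves a
slope in `[-1, 1]`. Everything the empirical process needs from the loss is this contraction
property. -/
theorem logit_lipschitz {y : ℝ} (hy : y = 0 ∨ y = 1) (u v : ℝ) :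
    |(-y * u + Real.log (1 + Real.exp u)) - (-y * v + Real.log (1 + Real.exp v))| ≤ |u - v| := by
  rcases le_total v u with h | h
  · have := log_one_add_exp_sub_mem h
    rw [abs_of_nonneg (sub_nonneg.2 h), abs_le]
    rcases hy with rfl | rfl <;> constructor <;> linarith
  · have := log_one_add_exp_sub_mem h
    rw [abs_of_nonpos (sub_nonpos.2 h), abs_le]
    rcases hy with rfl | rfl <;> constructor <;> linarith

theorem hasDerivAt_log_one_add_exp (u : ℝ) :
    HasDerivAt (fun t => Real.log (1 + Real.exp t)) (Real.exp u / (1 + Real.exp u)) u :=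
  ((Real.hasDerivAt_exp u).const_add 1).log (by positivity)

theorem hasDerivAt_logistic (u : ℝ) :
    HasDerivAt (fun t => Real.exp t / (1 + Real.exp t)) (Real.exp u / (1 + Real.exp u) ^ 2) u := by
  have h := (Real.hasDerivAt_exp u).div ((Real.hasDerivAt_exp u).const_add 1)
    (by positivity : 1 + Real.exp u ≠ 0)
  refine h.congr_deriv ?_
  rw [← sub_eq_zero]
  field_simp
  ring

theorem convexOn_log_one_add_exp :
    ConvexOn ℝ Set.univ fun t => Real.log (1 + Real.exp t) := by
  have hd : deriv (fun t => Real.log (1 + Real.exp t)) =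
      fun u => Real.exp u / (1 + Real.exp u) :=
    funext fun u => (hasDerivAt_log_one_add_exp u).deriv
  refine Monotone.convexOn_univ_of_deriv
    (fun u => (hasDerivAt_log_one_add_exp u).differentiableAt) ?_
  rw [hd]
  exact monotone_of_hasDerivAt_nonneg hasDerivAt_logistic fun u => by positivity

theorem logitLoss_convex {y s t u v : ℝ} (hs : 0 ≤ s) (ht : 0 ≤ t) (hst : s + t = 1) :
    -y * (s * u + t * v) + Real.log (1 + Real.exp (s * u + t * v)) ≤
      s * (-y * u + Real.log (1 + Real.exp u)) + t * (-y * v + Real.log (1 + Real.exp v)) := by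
  have := convexOn_log_one_add_exp.2 (Set.mem_univ u) (Set.mem_univ v) hs ht hst
  simp only [smul_eq_mul] at this
  linarith

/-- Second order expansion from below of the conditional risk at its minimizer. -/
theorem quadratic_lower_bound {ε0 η g : ℝ} (hε0 : 0 < ε0)
    (h1 : ε0 ≤ Real.exp g / (1 + Real.exp g)) (h2 : Real.exp g / (1 + Real.exp g) ≤ 1 - ε0)
    {f : ℝ} (hf : |f - g| ≤ η) :
    marginConst ε0 η * (f - g) ^ 2 ≤
      (-(Real.exp g / (1 + Real.exp g)) * f + Real.log (1 + Real.exp f)) -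
        (-(Real.exp g / (1 + Real.exp g)) * g + Real.log (1 + Real.exp g)) := by
  set c := marginConst ε0 η with hc
  have hgp := Real.exp_pos g
  have hη : 0 ≤ η := (abs_nonneg _).trans hf
  have heη : 1 ≤ Real.exp η := Real.one_le_exp hη
  have hlow : ε0 ≤ Real.exp g := by
    rw [le_div_iff₀ (by positivity)] at h1; nlinarith
  have hup : Real.exp g ≤ 1 / ε0 := by
    rw [div_le_iff₀ (by positivity)] at h2
    rw [le_div_iff₀ hε0]; nlinarith
  -- The numerator is bounded below through `e^g ≥ ε₀`, the denominator above through `e^g ≤ 1/ε₀`;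
  -- moving from `g` to `u` costs a factor `e^{±η}`. This is where the form of `marginConst` comes
  -- from.
  have hcurv : ∀ u, |u - g| ≤ η → 2 * c ≤ Real.exp u / (1 + Real.exp u) ^ 2 := by
    intro u hu
    rw [abs_le] at hu
    have e1 : ε0 * Real.exp (-η) ≤ Real.exp u := by
      calc ε0 * Real.exp (-η) ≤ Real.exp g * Real.exp (-η) := by gcongr
        _ = Real.exp (g - η) := by rw [← Real.exp_add]; ring_nf
        _ ≤ _ := Real.exp_le_exp.2 (by linarith)
    have e2 : Real.exp u ≤ Real.exp η / ε0 := by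
      calc Real.exp u ≤ Real.exp (g + η) := Real.exp_le_exp.2 (by linarith)
        _ = Real.exp g * Real.exp η := Real.exp_add _ _
        _ ≤ 1 / ε0 * Real.exp η := by gcongr
        _ = _ := by ring
    have : 2 * c = ε0 * Real.exp (-η) / (1 + Real.exp η / ε0) ^ 2 := by
      rw [hc, marginConst]; field_simp
    rw [this]
    have := Real.exp_pos u
    gcongr
  -- the remainder is convex near `g`, with a critical point at `g`
  set R : ℝ → ℝ := fun t =>
    -(Real.exp g / (1 + Real.exp g)) * t + Real.log (1 + Real.exp t) - c * (t - g) ^ 2 with hR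
  set R' : ℝ → ℝ := fun t =>
    -(Real.exp g / (1 + Real.exp g)) + Real.exp t / (1 + Real.exp t) - 2 * c * (t - g) with hR'
  have dR : ∀ t, HasDerivAt R (R' t) t := by
    intro t
    have := (((hasDerivAt_id t).const_mul (-(Real.exp g / (1 + Real.exp g)))).add
      (hasDerivAt_log_one_add_exp t)).sub ((((hasDerivAt_id t).sub_const g).pow 2).const_mul c)
    refine this.congr_deriv ?_
    simp [hR']; ring
  have dR' : ∀ t, HasDerivAt R' (Real.exp t / (1 + Real.exp t) ^ 2 - 2 * c) t := by
    intro t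
    have := ((hasDerivAt_logistic t).const_add (-(Real.exp g / (1 + Real.exp g)))).sub
      (((hasDerivAt_id t).sub_const g).const_mul (2 * c))
    refine this.congr_deriv ?_
    simp
  have mem : ∀ t, t ∈ Set.Icc (g - η) (g + η) ↔ |t - g| ≤ η := by
    intro t; rw [abs_le, Set.mem_Icc]; constructor <;> rintro ⟨_, _⟩ <;> constructor <;> linarith
  have hmono : MonotoneOn R' (Set.Icc (g - η) (g + η)) := by
    refine monotoneOn_of_hasDerivWithinAt_nonneg (convex_Icc _ _)
      (fun t _ => (dR' t).continuousAt.continuousWithinAt)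
      (fun t _ => (dR' t).hasDerivWithinAt) fun t ht => ?_
    have := hcurv t ((mem t).1 (interior_subset ht))
    linarith
  have hg : g ∈ Set.Icc (g - η) (g + η) := ⟨by linarith, by linarith⟩
  have hR'g : R' g = 0 := by simp [hR']
  have hfmem := (mem f).2 hf
  have key : R g ≤ R f := by
    rcases le_total g f with h | h
    · refine monotoneOn_of_hasDerivWithinAt_nonneg (f := R) (f' := R') (convex_Icc g f)
        (fun t _ => (dR t).continuousAt.continuousWithinAt)
        (fun t _ => (dR t).hasDerivWithinAt) (fun t ht => ?_) ⟨le_rfl, h⟩ ⟨h, le_rfl⟩ h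
      have ht := interior_subset ht
      rw [← hR'g]
      exact hmono hg ⟨hg.1.trans ht.1, ht.2.trans hfmem.2⟩ ht.1
    · refine antitoneOn_of_hasDerivWithinAt_nonpos (f := R) (f' := R') (convex_Icc f g)
        (fun t _ => (dR t).continuousAt.continuousWithinAt)
        (fun t _ => (dR t).hasDerivWithinAt) (fun t ht => ?_) ⟨le_rfl, h⟩ ⟨h, le_rfl⟩ h
      have ht := interior_subset ht
      rw [← hR'g]
      exact hmono ⟨hfmem.1.trans ht.1, ht.2.trans hg.2⟩ hg ht.2
  simp only [hR, sub_self] at key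
  linarith

theorem marginConst_pos {ε0 η : ℝ} (hε0 : 0 < ε0) : 0 < marginConst ε0 η := by
  unfold marginConst; positivity

/-! ### The quadratic margin -/

theorem strictConvexOn_quadMargin {c : ℝ} (hc : 0 < c) :
    StrictConvexOn ℝ (Set.Ici 0) (quadMargin c) := by
  refine ⟨convex_Ici 0, fun x _ y _ hxy s t hs ht hst => ?_⟩
  obtain rfl : s = 1 - t := by linarith
  simp only [quadMargin, smul_eq_mul]
  have h : 0 < c * ((1 - t) * t * (x - y) ^ 2) := by
    have : 0 < (x - y) ^ 2 := by have := sub_ne_zero.2 hxy; positivity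
    positivity
  nlinarith

theorem convConj_quadMargin {c : ℝ} (hc : 0 < c) {v : ℝ} (hv : 0 ≤ v) :
    convConj (quadMargin c) v = v ^ 2 / (4 * c) := by
  -- The maximizer `v / (2c)` is the stationary point of `u v - c u²`; it is admissible because `v ≥
  -- 0`.
  refine IsGreatest.csSup_eq ⟨⟨v / (2 * c), ?_, ?_⟩, ?_⟩
  · simp only [Set.mem_Ici]; positivity
  · simp only [quadMargin]; field_simp; ring
  · rintro _ ⟨u, -, rfl⟩
    simp only [quadMargin]
    rw [le_div_iff₀ (by positivity)]
    nlinarith [sq_nonneg (v - 2 * c * u)]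

/-! ### Norms and restrictions of coefficient vectors -/

section Vectors
variable {p : ℕ}

theorem l1_nonneg (v : Fin p → ℝ) : 0 ≤ l1 v := Finset.sum_nonneg fun _ _ => abs_nonneg _

theorem l2_nonneg (v : Fin p → ℝ) : 0 ≤ l2 v := Real.sqrt_nonneg _

theorem l2_sq (v : Fin p → ℝ) : l2 v ^ 2 = ∑ j, v j ^ 2 :=
  Real.sq_sqrt (Finset.sum_nonneg fun _ _ => sq_nonneg _)

theorem l2_eq_zero_iff {v : Fin p → ℝ} : l2 v = 0 ↔ v = 0 := by
  rw [← sq_eq_zero_iff, l2_sq, Finset.sum_eq_zero_iff_of_nonneg fun _ _ => sq_nonneg _]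
  simp [funext_iff]

theorem l2_pos {v : Fin p → ℝ} (hv : v ≠ 0) : 0 < l2 v :=
  (l2_nonneg v).lt_of_ne' fun h => hv (l2_eq_zero_iff.1 h)

theorem l1_smul (t : ℝ) (v : Fin p → ℝ) : l1 (t • v) = |t| * l1 v := by
  simp [l1, abs_mul, Finset.mul_sum]

theorem l1_add_le (v w : Fin p → ℝ) : l1 (v + w) ≤ l1 v + l1 w := by
  rw [l1, l1, l1, ← Finset.sum_add_distrib]
  exact Finset.sum_le_sum fun j _ => abs_add_le _ _

theorem l1_restr_add_restr_compl (S : Finset (Fin p)) (v : Fin p → ℝ) :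
    l1 v = l1 (restr S v) + l1 (restr Sᶜ v) := by
  rw [l1, l1, l1, ← Finset.sum_add_distrib]
  refine Finset.sum_congr rfl fun j _ => ?_
  by_cases h : j ∈ S <;> simp [restr, h]

theorem l2_restr_le (S : Finset (Fin p)) (v : Fin p → ℝ) : l2 (restr S v) ^ 2 ≤ l2 v ^ 2 := by
  rw [l2_sq, l2_sq]
  refine Finset.sum_le_sum fun j _ => ?_
  by_cases h : j ∈ S <;> simp [restr, h, sq_nonneg]

theorem l1_restr_le (S : Finset (Fin p)) (v : Fin p → ℝ) :
    l1 (restr S v) ≤ Real.sqrt S.card * l2 (restr S v) := by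
  have h := Finset.sum_mul_sq_le_sq_mul_sq Finset.univ
    (fun j => if j ∈ S then (1 : ℝ) else 0) (fun j => |restr S v j|)
  have e1 : ∑ j, (if j ∈ S then (1 : ℝ) else 0) * |restr S v j| = l1 (restr S v) := by
    refine Finset.sum_congr rfl fun j _ => ?_
    by_cases h : j ∈ S <;> simp [restr, h]
  have e2 : ∑ j, (if j ∈ S then (1 : ℝ) else 0) ^ 2 = S.card := by simp
  have e3 : ∑ j, |restr S v j| ^ 2 = l2 (restr S v) ^ 2 := by simp [l2_sq]
  rw [e1, e2, e3] at h
  refine abs_le_of_sq_le_sq' ?_ (mul_nonneg (Real.sqrt_nonneg _) (l2_nonneg _)) |>.2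
  rwa [mul_pow, Real.sq_sqrt (Nat.cast_nonneg _)]

theorem restr_supp (β : Fin p → ℝ) : restr (supp β) β = β := by
  funext j
  by_cases h : β j = 0 <;> simp [restr, supp, h]

theorem supp_card_pos {β : Fin p → ℝ} (hβ : β ≠ 0) : 0 < (supp β).card := by
  obtain ⟨j, hj⟩ := Function.ne_iff.1 hβ
  exact Finset.card_pos.2 ⟨j, by simpa [supp] using hj⟩

theorem restr_sub (S : Finset (Fin p)) (v w : Fin p → ℝ) :
    restr S (v - w) = restr S v - restr S w := by
  funext j
  by_cases h : j ∈ S <;> simp [restr, h]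

/-- The `ℓ₁` penalty decreases at least by the mass off the support. -/
theorem l1_sub_le (β b : Fin p → ℝ) :
    l1 β - l1 b ≤ l1 (restr (supp β) (b - β)) - l1 (restr (supp β)ᶜ (b - β)) := by
  rw [l1, l1, l1, l1, ← Finset.sum_sub_distrib, ← Finset.sum_sub_distrib]
  refine Finset.sum_le_sum fun j _ => ?_
  by_cases h : β j = 0
  · simp [restr, supp, h]
  · simp only [restr, supp, Finset.mem_filter, Finset.mem_univ, true_and, ne_eq, h,
      not_false_eq_true, if_true, Finset.mem_compl, not_true, if_false, Pi.sub_apply, abs_zero,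
      sub_zero]
    have := abs_sub_abs_le_abs_sub (β j) (b j)
    rwa [abs_sub_comm] at this

/-- The ridge penalty at `β` exceeds the one at `b` by at most a linear term. -/
theorem l2_sq_sub_le (β b : Fin p → ℝ) :
    l2 β ^ 2 - l2 b ^ 2 ≤ 2 * l2 β * l2 (restr (supp β) (b - β))
      - l2 (restr (supp β) (b - β)) ^ 2 := by
  have hcs : -(∑ j, β j * restr (supp β) (b - β) j) ≤ l2 β * l2 (restr (supp β) (b - β)) := by
    refine (neg_le_abs _).trans ?_
    refine abs_le_of_sq_le_sq ?_ (mul_nonneg (l2_nonneg _) (l2_nonneg _))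
    rw [mul_pow, l2_sq, l2_sq]
    exact Finset.sum_mul_sq_le_sq_mul_sq _ _ _
  have h : l2 β ^ 2 - l2 b ^ 2 ≤ -2 * (∑ j, β j * restr (supp β) (b - β) j)
      - l2 (restr (supp β) (b - β)) ^ 2 := by
    rw [l2_sq, l2_sq, l2_sq, Finset.mul_sum, ← Finset.sum_sub_distrib, ← Finset.sum_sub_distrib]
    refine Finset.sum_le_sum fun j _ => ?_
    -- Off the support the claim is `-b_j² ≤ 0`; on it, it is an identity, the expansion of `b_j²`
    -- around `β_j`.
    by_cases h : β j = 0
    · simp [restr, supp, h, sq_nonneg]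
    · simp only [restr, supp, Finset.mem_filter, Finset.mem_univ, true_and, ne_eq, h,
        not_false_eq_true, if_true, Pi.sub_apply]
      exact le_of_eq (by ring)
  linarith

theorem abs_linComb_le {𝒳 : Type*} {ψ : Fin p → 𝒳 → ℝ} {K : ℝ} (hψ : ∀ j, SupNormLE (ψ j) K)
    (b : Fin p → ℝ) (x : 𝒳) : |linComb ψ b x| ≤ l1 b * K := by
  rw [linComb, l1, Finset.sum_mul]
  refine (Finset.abs_sum_le_sum_abs _ _).trans (Finset.sum_le_sum fun j _ => ?_)
  rw [abs_mul]
  exact mul_le_mul_of_nonneg_left (hψ j x) (abs_nonneg _)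

theorem linComb_sub {𝒳 : Type*} (ψ : Fin p → 𝒳 → ℝ) (b b' : Fin p → ℝ) :
    linComb ψ (b - b') = linComb ψ b - linComb ψ b' := by
  funext x
  simp [linComb, sub_mul, Finset.sum_sub_distrib]

theorem linComb_convex {𝒳 : Type*} (ψ : Fin p → 𝒳 → ℝ) (s t : ℝ) (b b' : Fin p → ℝ) (x : 𝒳) :
    linComb ψ (s • b + t • b') x = s * linComb ψ b x + t * linComb ψ b' x := by
  simp only [linComb, Finset.mul_sum, ← Finset.sum_add_distrib]
  exact Finset.sum_congr rfl fun j _ => by simp; ring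

theorem linComb_mem {𝒳 : Type*} {ψ : Fin p → 𝒳 → ℝ} {F : Submodule ℝ (𝒳 → ℝ)}
    (hψ : ∀ j, ψ j ∈ F) (b : Fin p → ℝ) : linComb ψ b ∈ F := by
  have : linComb ψ b = ∑ j, b j • ψ j := by
    funext x
    simp [linComb]
  rw [this]
  exact Submodule.sum_mem _ fun j _ => F.smul_mem _ (hψ j)

/-- The elastic net penalty is convex. -/
theorem penalty_convex {lam1 lam2 s t : ℝ} (h1 : 0 ≤ lam1) (h2 : 0 ≤ lam2) (hs : 0 ≤ s)
    (ht : 0 ≤ t) (hst : s + t = 1) (b b' : Fin p → ℝ) :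
    lam1 * l1 (s • b + t • b') + lam2 * l2 (s • b + t • b') ^ 2 ≤
      s * (lam1 * l1 b + lam2 * l2 b ^ 2) + t * (lam1 * l1 b' + lam2 * l2 b' ^ 2) := by
  have e1 : l1 (s • b + t • b') ≤ s * l1 b + t * l1 b' := by
    refine (l1_add_le _ _).trans ?_
    rw [l1_smul, l1_smul, abs_of_nonneg hs, abs_of_nonneg ht]
  have e2 : l2 (s • b + t • b') ^ 2 ≤ s * l2 b ^ 2 + t * l2 b' ^ 2 := by
    rw [l2_sq, l2_sq, l2_sq, Finset.mul_sum, Finset.mul_sum, ← Finset.sum_add_distrib]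
    refine Finset.sum_le_sum fun j _ => ?_
    obtain rfl : s = 1 - t := by linarith
    simp only [Pi.add_apply, Pi.smul_apply, smul_eq_mul]
    nlinarith [mul_nonneg (mul_nonneg hs ht) (sq_nonneg (b j - b' j))]
  nlinarith [mul_le_mul_of_nonneg_left e1 h1, mul_le_mul_of_nonneg_left e2 h2]

end Vectors

/-- The arithmetic of the oracle inequality: `A`, `B`, `D` are the `ℓ₂`-norm and the `ℓ₁`-norm on
the active set and the `ℓ₁`-norm off it, `ξ` and `ξs` are excess risks, `r = √s`. -/
theorem oracle_arith {A B D ξ ξs lam1 lam2 r φ c Δ : ℝ} (hA : 0 ≤ A)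
    (hξs : 0 ≤ ξs) (hl1 : 0 < lam1) (hφ : 0 < φ) (hc : 0 < c) (hr : 0 ≤ r)
    (hBA : B ≤ r * A) (hl2 : 0 ≤ lam2) (hBD : 0 ≤ B + D)
    (hΔ : Δ = 3 / 2 * ξs + 9 * lam1 ^ 2 * r ^ 2 / (φ ^ 2 * c))
    (hbasic : ξ + lam1 * D + lam2 * A ^ 2 ≤ Δ + ξs + lam1 * B + lam1 * r * A) (hξ : 0 ≤ ξ)
    (hcone : D ≤ 6 * r * A → ∃ N : ℝ, φ * A ≤ N ∧ c * N ^ 2 ≤ 2 * (ξ + ξs)) :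
    ξ + lam1 * (B + D) + lam2 * A ^ 2 ≤ 4 * Δ := by
  have hH : 0 ≤ 9 * lam1 ^ 2 * r ^ 2 / (φ ^ 2 * c) := by positivity
  have hB : lam1 * B ≤ lam1 * (r * A) := mul_le_mul_of_nonneg_left hBA hl1.le
  have hlA : 0 ≤ lam2 * A ^ 2 := by positivity
  have hrA : 0 ≤ lam1 * (r * A) := by positivity
  -- With `T` the left side, the basic inequality gives `T ≤ Δ + ξs + 3 λ₁ r A`. In the first case
  -- `λ₁ D ≤ (4 + 1 + 1) λ₁ r A`, which is the cone condition. In the second, `T ≤ (7/4)(Δ + ξs)`,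
  -- and `ξs ≤ (2/3) Δ` suffices.
  rcases le_total (Δ + ξs) (4 * (lam1 * (r * A))) with h | h
  · obtain ⟨N, h1, h2⟩ := hcone <| by
      refine le_of_mul_le_mul_left ?_ hl1
      nlinarith
    have young : 3 * lam1 * r / φ * N ≤
        9 * lam1 ^ 2 * r ^ 2 / (φ ^ 2 * c) + c * N ^ 2 / 4 := by
      have e : 9 * lam1 ^ 2 * r ^ 2 / (φ ^ 2 * c) + c * N ^ 2 / 4 - 3 * lam1 * r / φ * N =
          (3 * lam1 * r / φ - c * N / 2) ^ 2 / c := by field_simp; ring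
      have : 0 ≤ (3 * lam1 * r / φ - c * N / 2) ^ 2 / c := by positivity
      linarith
    have h4 : 3 * lam1 * (r * A) ≤ 3 * lam1 * r / φ * N := by
      calc 3 * lam1 * (r * A) = 3 * lam1 * r / φ * (φ * A) := by field_simp
        _ ≤ _ := by gcongr
    have h5 := mul_nonneg hl1.le hBD
    -- Young turns `3 λ₁ r A` into the conjugate term plus `(ξ + ξs) / 2`, so `T ≤ 2Δ + ξ / 2`.
    -- Moving `ξ / 2` to the left and doubling gives `4Δ`, as the penalty part of `T` is
    -- nonnegative.
    linarith
  · linarith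

/-! ### Exponential moments of suprema -/

section ExpSup
variable {ι : Type*} [Fintype ι] [Nonempty ι]

/-- The exponential of the maximum of a finite family of reals. -/
noncomputable def expSup (a : ι → ℝ) : ℝ :=
  Finset.univ.sup' Finset.univ_nonempty fun i => Real.exp (a i)

theorem le_expSup (a : ι → ℝ) (i : ι) : Real.exp (a i) ≤ expSup a :=
  Finset.le_sup' (fun i => Real.exp (a i)) (Finset.mem_univ i)

theorem expSup_le {a : ι → ℝ} {r : ℝ} (h : ∀ i, Real.exp (a i) ≤ r) : expSup a ≤ r :=
  Finset.sup'_le _ _ fun i _ => h i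

theorem exists_expSup_eq (a : ι → ℝ) : ∃ i, expSup a = Real.exp (a i) := by
  obtain ⟨i, -, h⟩ := Finset.exists_mem_eq_sup' Finset.univ_nonempty fun i => Real.exp (a i)
  exact ⟨i, h⟩

theorem expSup_nonneg (a : ι → ℝ) : 0 ≤ expSup a :=
  (Real.exp_pos _).le.trans (le_expSup a (Classical.arbitrary ι))

theorem expSup_le_sum (a : ι → ℝ) : expSup a ≤ ∑ i, Real.exp (a i) :=
  expSup_le fun i => Finset.single_le_sum (f := fun i => Real.exp (a i))
    (fun _ _ => (Real.exp_pos _).le) (Finset.mem_univ i)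

theorem integrable_expSup {Z : Type*} [MeasurableSpace Z] {μ : Measure Z} [IsFiniteMeasure μ]
    {f : ι → Z → ℝ} (hf : ∀ i, Measurable (f i)) {C : ι → ℝ} (hC : ∀ i z, f i z ≤ C i) :
    Integrable (fun z => expSup fun i => f i z) μ := by
  refine Integrable.of_bound (C := ∑ i, Real.exp (C i)) ?_ (ae_of_all _ fun z => ?_)
  · have : (fun z => expSup fun i => f i z) =
        Finset.univ.sup' Finset.univ_nonempty fun i z => Real.exp (f i z) := by
      funext z
      rw [Finset.sup'_apply]
      rfl
    rw [this]
    exact (Finset.measurable_sup' _ fun i _ => (hf i).exp).aestronglyMeasurable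
  · rw [Real.norm_of_nonneg (expSup_nonneg _)]
    exact (expSup_le_sum _).trans (Finset.sum_le_sum fun i _ => Real.exp_le_exp.2 (hC i z))

/-- Convexity and monotonicity: the exponential grows more over a longer step taken from a higher
starting point. -/
theorem exp_increment_le {x y s t : ℝ} (hxy : x ≤ y) (hs : 0 ≤ s) (hst : s ≤ t) :
    Real.exp (x + s) + Real.exp y ≤ Real.exp (y + t) + Real.exp x := by
  have h1 := Real.exp_le_exp.2 hxy
  have h2 := Real.exp_le_exp.2 hst
  have h3 := Real.one_le_exp hs
  rw [Real.exp_add, Real.exp_add]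
  nlinarith [mul_le_mul h1 (sub_le_sub_right h2 1) (sub_nonneg.2 h3) (Real.exp_pos y).le]

/-- One step of the Ledoux–Talagrand contraction principle, for the exponential function. -/
theorem expSup_contraction (a h u : ι → ℝ) (hlip : ∀ i k, |h i - h k| ≤ |u i - u k|)
    (hle : ∀ i, |h i| ≤ |u i|) :
    expSup (fun i => a i + h i) + expSup (fun i => a i - h i) ≤
      expSup (fun i => a i + u i) + expSup (fun i => a i - u i) := by
  obtain ⟨i, hi⟩ := exists_expSup_eq fun i => a i + h i
  obtain ⟨k, hk⟩ := exists_expSup_eq fun i => a i - h i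
  have hki : a k + h k ≤ a i + h i := by
    have := le_expSup (fun i => a i + h i) k
    rwa [hi, Real.exp_le_exp] at this
  have hik : a i - h i ≤ a k - h k := by
    have := le_expSup (fun i => a i - h i) i
    rwa [hk, Real.exp_le_exp] at this
  rw [hi, hk]
  -- Changing the sign of `u` swaps the two suprema on the right, so `u k ≥ 0` may be assumed.
  suffices H : ∀ v : ι → ℝ, (∀ i k, |h i - h k| ≤ |v i - v k|) → (∀ i, |h i| ≤ |v i|) → 0 ≤ v k →
      Real.exp (a i + h i) + Real.exp (a k - h k) ≤
        expSup (fun i => a i + v i) + expSup (fun i => a i - v i) by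
    rcases le_total 0 (u k) with h0 | h0
    · exact H u hlip hle h0
    · have := H (fun i => -u i) (fun i k => by
        rw [show -u i - -u k = -(u i - u k) by ring, abs_neg]; exact hlip i k)
        (fun i => by rw [abs_neg]; exact hle i) (by simpa using h0)
      simp only [← sub_eq_add_neg, sub_neg_eq_add] at this
      linarith
  intro v hl hv hk0
  have vi := hv i
  have vk := hv k
  have vik := hl i k
  have p1 := le_expSup (fun i => a i + v i) i
  have p2 := le_expSup (fun i => a i + v i) k
  have p3 := le_expSup (fun i => a i - v i) i
  have p4 := le_expSup (fun i => a i - v i) k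
  rw [abs_of_nonneg hk0, abs_le] at vk
  -- Here `i` and `k` are the maximizers for the two signs of `h`. If `v i` and `v k` have the same
  -- sign, the index with the larger value takes the plus sign on the right, and convexity of the
  -- exponential pays for the other one. If the signs are opposite, `i` takes the minus sign, `k`
  -- the plus sign, and each term increases separately.
  rcases le_total 0 (v i) with hi0 | hi0
  · rw [abs_of_nonneg hi0, abs_le] at vi
    rcases le_total (v k) (v i) with hc | hc
    · rw [abs_of_nonneg (sub_nonneg.2 hc), abs_le] at vik
      have := exp_increment_le (x := a k - v k) (y := a i + h i) (s := v k - h k)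
        (t := v i - h i) (by linarith) (by linarith) (by linarith)
      rw [show a k - v k + (v k - h k) = a k - h k by ring,
        show a i + h i + (v i - h i) = a i + v i by ring] at this
      linarith
    · rw [abs_of_nonpos (sub_nonpos.2 hc), abs_le] at vik
      have := exp_increment_le (x := a i - v i) (y := a k - h k) (s := v i + h i)
        (t := v k + h k) (by linarith) (by linarith) (by linarith)
      rw [show a i - v i + (v i + h i) = a i + h i by ring,
        show a k - h k + (v k + h k) = a k + v k by ring] at this
      linarith
  · rw [abs_of_nonpos hi0, abs_le] at vi
    have q1 : Real.exp (a i + h i) ≤ Real.exp (a i - v i) := Real.exp_le_exp.2 (by linarith)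
    have q2 : Real.exp (a k - h k) ≤ Real.exp (a k + v k) := Real.exp_le_exp.2 (by linarith)
    linarith

/-- The exponential of a supremum of averages. -/
theorem expSup_midpoint_le (a b : ι → ℝ) :
    expSup (fun i => (a i + b i) / 2) ≤ (expSup a + expSup b) / 2 := by
  refine expSup_le fun i => ?_
  have h := convexOn_exp.2 (Set.mem_univ (a i)) (Set.mem_univ (b i))
    (by norm_num : (0 : ℝ) ≤ 1 / 2) (by norm_num : (0 : ℝ) ≤ 1 / 2) (by norm_num)
  simp only [smul_eq_mul] at h
  rw [show 1 / 2 * a i + 1 / 2 * b i = (a i + b i) / 2 by ring] at h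
  have := le_expSup a i
  have := le_expSup b i
  linarith

/-- Symmetrization and contraction for a single observation. -/
theorem integral_expSup_centered_le {Z : Type*} [MeasurableSpace Z] (μ : Measure Z)
    [IsProbabilityMeasure μ] (a : ι → ℝ) {h u : ι → Z → ℝ} (hh : ∀ i, Measurable (h i))
    (hu : ∀ i, Measurable (u i)) (hlip : ∀ i k z, |h i z - h k z| ≤ |u i z - u k z|)
    (hle : ∀ i z, |h i z| ≤ |u i z|) {B : ℝ} (hB : ∀ i z, |u i z| ≤ B) :
    ∫ z, expSup (fun i => a i + (h i z - ∫ z', h i z' ∂μ)) ∂μ ≤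
      ∫ z, (expSup (fun i => a i + 2 * u i z) + expSup (fun i => a i - 2 * u i z)) / 2 ∂μ := by
  set m : ι → ℝ := fun i => ∫ z', h i z' ∂μ with hm
  have hhB : ∀ i z, -B ≤ h i z ∧ h i z ≤ B := fun i z => abs_le.1 ((hle i z).trans (hB i z))
  have huB : ∀ i z, -B ≤ u i z ∧ u i z ≤ B := fun i z => abs_le.1 (hB i z)
  have hint : ∀ i, Integrable (h i) μ := fun i =>
    Integrable.of_bound (hh i).aestronglyMeasurable B (ae_of_all _ fun z => (hle i z).trans (hB i z))
  have i1 : Integrable (fun z => expSup fun i => a i + 2 * h i z) μ :=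
    integrable_expSup (fun i => by have := hh i; fun_prop) (C := fun i => a i + 2 * B)
      fun i z => by linarith [(hhB i z).2]
  have i2 : Integrable (fun z => expSup fun i => a i - 2 * h i z) μ :=
    integrable_expSup (fun i => by have := hh i; fun_prop) (C := fun i => a i + 2 * B)
      fun i z => by linarith [(hhB i z).1]
  have i3 : Integrable (fun z => expSup fun i => a i + 2 * u i z) μ :=
    integrable_expSup (fun i => by have := hu i; fun_prop) (C := fun i => a i + 2 * B)
      fun i z => by linarith [(huB i z).2]
  have i4 : Integrable (fun z => expSup fun i => a i - 2 * u i z) μ :=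
    integrable_expSup (fun i => by have := hu i; fun_prop) (C := fun i => a i + 2 * B)
      fun i z => by linarith [(huB i z).1]
  have i5 : Integrable (fun z => expSup fun i => a i + (h i z - m i)) μ :=
    integrable_expSup (fun i => by have := hh i; fun_prop) (C := fun i => a i + (B - m i))
      fun i z => by linarith [(hhB i z).2]
  -- Jensen
  have hJ : expSup (fun i => a i - 2 * m i) ≤ ∫ z, expSup (fun i => a i - 2 * h i z) ∂μ := by
    refine expSup_le fun i => ?_
    have hmi : Integrable (fun z => m i - h i z) μ := (integrable_const _).sub (hint i)
    -- The tangent line of the exponential at the mean integrates exactly to its value there, so `x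
    -- + 1 ≤ e^x` gives the inequality for each index.
    have e : ∫ z, Real.exp (a i - 2 * m i) * (2 * (m i - h i z) + 1) ∂μ =
        Real.exp (a i - 2 * m i) := by
      rw [integral_const_mul, integral_add (hmi.const_mul 2) (integrable_const _),
        integral_const_mul, integral_sub (integrable_const _) (hint i)]
      simp [hm]
    rw [← e]
    refine integral_mono (((hmi.const_mul 2).add (integrable_const _)).const_mul _) i2 fun z => ?_
    refine le_trans ?_ (le_expSup _ i)
    calc Real.exp (a i - 2 * m i) * (2 * (m i - h i z) + 1)
        ≤ Real.exp (a i - 2 * m i) * Real.exp (2 * (m i - h i z)) :=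
          mul_le_mul_of_nonneg_left (Real.add_one_le_exp _) (Real.exp_pos _).le
      _ = Real.exp (a i - 2 * h i z) := by rw [← Real.exp_add]; ring_nf
  -- Since `a + (h - m)` is the midpoint of `a + 2h` and `a - 2m`, convexity separates the
  -- observation from its mean, and Jensen turns `-2m` into `-2h`. The result is the average over a
  -- random sign, to which the contraction step applies; the doubling is the usual price of
  -- symmetrization.
  calc ∫ z, expSup (fun i => a i + (h i z - m i)) ∂μ
      ≤ ∫ z, (expSup (fun i => a i + 2 * h i z) + expSup (fun i => a i - 2 * m i)) / 2 ∂μ := by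
        refine integral_mono i5 ((i1.add (integrable_const _)).div_const 2) fun z => ?_
        refine le_trans (le_of_eq ?_) (expSup_midpoint_le _ _)
        congr 1
        funext i
        ring
    _ = (∫ z, expSup (fun i => a i + 2 * h i z) ∂μ + expSup (fun i => a i - 2 * m i)) / 2 := by
        rw [integral_div, integral_add i1 (integrable_const _)]
        simp
    _ ≤ (∫ z, expSup (fun i => a i + 2 * h i z) ∂μ +
          ∫ z, expSup (fun i => a i - 2 * h i z) ∂μ) / 2 := by linarith
    _ = ∫ z, (expSup (fun i => a i + 2 * h i z) + expSup (fun i => a i - 2 * h i z)) / 2 ∂μ := by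
        rw [integral_div, integral_add i1 i2]
    _ ≤ _ := by
        refine integral_mono ((i1.add i2).div_const 2) ((i3.add i4).div_const 2) fun z => ?_
        have := expSup_contraction a (fun i => 2 * h i z) (fun i => 2 * u i z)
          (fun i k => by
            rw [← mul_sub, ← mul_sub, abs_mul, abs_mul]
            exact mul_le_mul_of_nonneg_left (hlip i k z) (abs_nonneg _))
          (fun i => by
            rw [abs_mul, abs_mul]
            exact mul_le_mul_of_nonneg_left (hle i z) (abs_nonneg _))
        simp only
        linarith

/-- Exponential moment of the supremum of a centered empirical process whose increments are
dominated by those of a linear process with coefficients in an `ℓ₁`-ball of radius `M`. -/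
theorem integral_expSup_pi_le {Z : Type*} [MeasurableSpace Z] (μ : Measure Z)
    [IsProbabilityMeasure μ] {p : ℕ} [NeZero p] {ψ : Fin p → Z → ℝ} (hψ : ∀ j, Measurable (ψ j))
    {K : ℝ} (hK : 0 ≤ K) (hψK : ∀ j z, |ψ j z| ≤ K) {b : ι → Fin p → ℝ} {M : ℝ}
    (hb : ∀ i, l1 (b i) ≤ M) {h : ι → Z → ℝ} (hh : ∀ i, Measurable (h i))
    (hlip : ∀ i k z, |h i z - h k z| ≤ |linComb ψ (b i) z - linComb ψ (b k) z|)
    (hle : ∀ i z, |h i z| ≤ |linComb ψ (b i) z|) (n : ℕ) :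
    ∀ w : Fin p → ℝ,
    ∫ z : Fin n → Z, expSup (fun i => ∑ j, b i j * w j + ∑ k, (h i (z k) - ∫ z', h i z' ∂μ))
        ∂(Measure.pi fun _ => μ) ≤
      (∑ j, (Real.exp (M * w j) + Real.exp (-(M * w j)))) * Real.exp (n * (2 * M ^ 2 * K ^ 2)) := by
  have hM : 0 ≤ M := (l1_nonneg _).trans (hb (Classical.arbitrary ι))
  set m : ι → ℝ := fun i => ∫ z', h i z' ∂μ with hm
  have hum : ∀ i, Measurable (linComb ψ (b i)) := fun i =>
    Finset.measurable_fun_sum _ fun j _ => (hψ j).const_mul _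
  have huB : ∀ i z, |linComb ψ (b i) z| ≤ M * K := fun i z =>
    (abs_linComb_le hψK _ _).trans (mul_le_mul_of_nonneg_right (hb i) hK)
  have hhB : ∀ i z, h i z ≤ M * K := fun i z =>
    (le_abs_self _).trans ((hle i z).trans (huB i z))
  have huB' : ∀ i z, -(M * K) ≤ linComb ψ (b i) z ∧ linComb ψ (b i) z ≤ M * K :=
    fun i z => abs_le.1 (huB i z)
  -- The shift `w` is general because integrating out one observation `x` replaces `w` by `w ±
  -- 2ψ(x)`. In the base case the linear form is at most `M max |w_j|`, and the maximum is bounded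
  -- by the sum over coordinates and signs.
  induction n with
  | zero =>
    intro w
    simp only [Finset.univ_eq_empty, Finset.sum_empty, add_zero, integral_const, probReal_univ,
      one_smul, CharP.cast_eq_zero, zero_mul, Real.exp_zero, mul_one]
    refine expSup_le fun i => ?_
    obtain ⟨j, -, hj⟩ := Finset.exists_max_image Finset.univ (fun j => |w j|)
      (Finset.univ_nonempty (α := Fin p))
    have h1 : ∑ k, b i k * w k ≤ M * |w j| := by
      calc ∑ k, b i k * w k ≤ ∑ k, |b i k| * |w j| := by
            refine Finset.sum_le_sum fun k _ => (le_abs_self _).trans ?_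
            rw [abs_mul]
            exact mul_le_mul_of_nonneg_left (hj k (Finset.mem_univ k)) (abs_nonneg _)
        _ = l1 (b i) * |w j| := by rw [l1, Finset.sum_mul]
        _ ≤ _ := mul_le_mul_of_nonneg_right (hb i) (abs_nonneg _)
    calc Real.exp (∑ k, b i k * w k) ≤ Real.exp (M * |w j|) := Real.exp_le_exp.2 h1
      _ ≤ Real.exp (M * w j) + Real.exp (-(M * w j)) := by
          have := Real.exp_pos (M * w j)
          have := Real.exp_pos (-(M * w j))
          rcases abs_choice (w j) with e | e <;> rw [e]
          · linarith
          · rw [mul_neg]; linarith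
      _ ≤ _ := Finset.single_le_sum (f := fun j => Real.exp (M * w j) + Real.exp (-(M * w j)))
          (fun _ _ => by positivity) (Finset.mem_univ j)
  | succ n ih =>
    intro w
    set T : ι → (Fin n → Z) → ℝ := fun i z => ∑ j, b i j * w j + ∑ k, (h i (z k) - m i) with hT
    have hTm : ∀ i, Measurable (T i) := fun i => by
      refine Measurable.const_add (Finset.measurable_fun_sum _ fun k _ => ?_) _
      exact ((hh i).comp (measurable_pi_apply k)).sub_const _
    have hTB : ∀ i z, T i z ≤ ∑ j, b i j * w j + ∑ _k : Fin n, (M * K - m i) := fun i z =>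
      add_le_add le_rfl (Finset.sum_le_sum fun k _ => sub_le_sub_right (hhB i _) _)
    have int1 : Integrable (fun q : Z × (Fin n → Z) => expSup fun i => T i q.2 + (h i q.1 - m i))
        (μ.prod (Measure.pi fun _ => μ)) :=
      integrable_expSup (fun i => by have := hTm i; have := hh i; fun_prop)
        (C := fun i => (∑ j, b i j * w j + ∑ _k : Fin n, (M * K - m i)) + (M * K - m i))
        fun i q => add_le_add (hTB i _) (sub_le_sub_right (hhB i _) _)
    have int2 : Integrable (fun q : Z × (Fin n → Z) =>
        expSup fun i => T i q.2 + 2 * linComb ψ (b i) q.1) (μ.prod (Measure.pi fun _ => μ)) :=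
      integrable_expSup (fun i => by have := hTm i; have := hum i; fun_prop)
        (C := fun i => (∑ j, b i j * w j + ∑ _k : Fin n, (M * K - m i)) + 2 * (M * K))
        fun i q => add_le_add (hTB i _) (by linarith [(huB' i q.1).2])
    have int3 : Integrable (fun q : Z × (Fin n → Z) =>
        expSup fun i => T i q.2 - 2 * linComb ψ (b i) q.1) (μ.prod (Measure.pi fun _ => μ)) :=
      integrable_expSup (fun i => by have := hTm i; have := hum i; fun_prop)
        (C := fun i => (∑ j, b i j * w j + ∑ _k : Fin n, (M * K - m i)) + 2 * (M * K))
        fun i q => by linarith [(huB' i q.1).1, hTB i q.2]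
    -- With `x` fixed, the linear term joins the deterministic part, so the induction hypothesis
    -- applies at a shifted `w`. The order of integration is exchanged below so that `x` is indeed
    -- fixed.
    have shift : ∀ x : Z, ∀ σ : ℝ, (∫ z : Fin n → Z,
        expSup (fun i => T i z + σ * linComb ψ (b i) x) ∂(Measure.pi fun _ => μ)) ≤
        (∑ j, (Real.exp (M * (w j + σ * ψ j x)) + Real.exp (-(M * (w j + σ * ψ j x))))) *
          Real.exp (n * (2 * M ^ 2 * K ^ 2)) := by
      intro x σ
      refine le_trans (le_of_eq ?_) (ih fun j => w j + σ * ψ j x)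
      refine integral_congr_ae (ae_of_all _ fun z => ?_)
      simp only [hT]
      congr 1
      funext i
      simp only [linComb, mul_add, Finset.sum_add_distrib, Finset.mul_sum]
      have : ∑ j, σ * (b i j * ψ j x) = ∑ j, b i j * (σ * ψ j x) :=
        Finset.sum_congr rfl fun j _ => by ring
      rw [this]
      ring
    -- Averaging over the two shifts multiplies each coordinate's contribution by `cosh (2Mψ_j(x)) ≤
    -- exp (2M²K²)`, the factor gained per observation.
    have hcosh : ∀ x : Z, ∀ j, (Real.exp (M * (w j + 2 * ψ j x)) +
        Real.exp (-(M * (w j + 2 * ψ j x)))) + (Real.exp (M * (w j + (-2) * ψ j x)) +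
        Real.exp (-(M * (w j + (-2) * ψ j x)))) ≤
        2 * ((Real.exp (M * w j) + Real.exp (-(M * w j))) * Real.exp (2 * M ^ 2 * K ^ 2)) := by
      intro x j
      have e : (Real.exp (M * (w j + 2 * ψ j x)) +
          Real.exp (-(M * (w j + 2 * ψ j x)))) + (Real.exp (M * (w j + (-2) * ψ j x)) +
          Real.exp (-(M * (w j + (-2) * ψ j x)))) =
          2 * ((Real.exp (M * w j) + Real.exp (-(M * w j))) * Real.cosh (2 * M * ψ j x)) := by
        have a1 : Real.exp (M * (w j + 2 * ψ j x)) =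
          Real.exp (M * w j) * Real.exp (2 * M * ψ j x) := by rw [← Real.exp_add]; ring_nf
        have a2 : Real.exp (-(M * (w j + 2 * ψ j x))) =
          Real.exp (-(M * w j)) * Real.exp (-(2 * M * ψ j x)) := by rw [← Real.exp_add]; ring_nf
        have a3 : Real.exp (M * (w j + (-2) * ψ j x)) =
          Real.exp (M * w j) * Real.exp (-(2 * M * ψ j x)) := by rw [← Real.exp_add]; ring_nf
        have a4 : Real.exp (-(M * (w j + (-2) * ψ j x))) =
          Real.exp (-(M * w j)) * Real.exp (2 * M * ψ j x) := by rw [← Real.exp_add]; ring_nf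
        rw [a1, a2, a3, a4, Real.cosh_eq]
        ring
      rw [e]
      have h1 : Real.cosh (2 * M * ψ j x) ≤ Real.exp (2 * M ^ 2 * K ^ 2) := by
        refine (Real.cosh_le_exp_half_sq _).trans (Real.exp_le_exp.2 ?_)
        have : ψ j x ^ 2 ≤ K ^ 2 := sq_le_sq' (abs_le.1 (hψK j x)).1 (abs_le.1 (hψK j x)).2
        have := mul_le_mul_of_nonneg_left this (by positivity : 0 ≤ 2 * M ^ 2)
        linarith [this, (by ring : (2 * M * ψ j x) ^ 2 / 2 = 2 * M ^ 2 * ψ j x ^ 2)]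
      gcongr
    have hmp := (measurePreserving_piFinSuccAbove (fun _ : Fin (n + 1) => μ) 0).symm
    calc ∫ z : Fin (n + 1) → Z, expSup (fun i => ∑ j, b i j * w j + ∑ k, (h i (z k) - m i))
          ∂(Measure.pi fun _ => μ)
        = ∫ q : Z × (Fin n → Z), expSup (fun i => T i q.2 + (h i q.1 - m i))
            ∂(μ.prod (Measure.pi fun _ => μ)) := by
          rw [← hmp.integral_comp' ]
          refine integral_congr_ae (ae_of_all _ fun q => ?_)
          simp only [hT]
          congr 1
          funext i
          rw [Fin.sum_univ_succ]
          simp [MeasurableEquiv.piFinSuccAbove]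
          ring
      _ = ∫ z, ∫ x, expSup (fun i => T i z + (h i x - m i)) ∂μ ∂(Measure.pi fun _ => μ) :=
          integral_prod_symm _ int1
      _ ≤ ∫ z, ∫ x, (expSup (fun i => T i z + 2 * linComb ψ (b i) x) +
            expSup (fun i => T i z - 2 * linComb ψ (b i) x)) / 2 ∂μ ∂(Measure.pi fun _ => μ) := by
          refine integral_mono int1.integral_prod_right
            (((int2.add int3).div_const 2).integral_prod_right) fun z => ?_
          exact integral_expSup_centered_le μ (fun i => T i z) hh hum hlip hle huB
      _ = ∫ x, ∫ z, (expSup (fun i => T i z + 2 * linComb ψ (b i) x) +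
            expSup (fun i => T i z - 2 * linComb ψ (b i) x)) / 2 ∂(Measure.pi fun _ => μ) ∂μ :=
          (integral_integral_swap ((int2.add int3).div_const 2)).symm
      _ ≤ ∫ _x : Z, (∑ j, (Real.exp (M * w j) + Real.exp (-(M * w j)))) *
            Real.exp ((n + 1 : ℕ) * (2 * M ^ 2 * K ^ 2)) ∂μ := by
          refine integral_mono_ae (((int2.add int3).div_const 2).integral_prod_left)
            (integrable_const _) ?_
          filter_upwards [int2.prod_right_ae, int3.prod_right_ae] with x hx2 hx3
          rw [integral_div, integral_add hx2 hx3]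
          have s1 := shift x 2
          have s2 := shift x (-2)
          have e2 : (fun z => expSup fun i => T i z + -2 * linComb ψ (b i) x) =
              fun z => expSup fun i => T i z - 2 * linComb ψ (b i) x := by
            funext z; congr 1; funext i; ring
          rw [e2] at s2
          have hs := Finset.sum_le_sum fun j (_ : j ∈ Finset.univ) => hcosh x j
          rw [Finset.sum_add_distrib, ← Finset.mul_sum, ← Finset.sum_mul] at hs
          have e3 : Real.exp ((n + 1 : ℕ) * (2 * M ^ 2 * K ^ 2)) =
              Real.exp (2 * M ^ 2 * K ^ 2) * Real.exp (n * (2 * M ^ 2 * K ^ 2)) := by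
            rw [← Real.exp_add]; push_cast; ring_nf
          rw [e3]
          have := mul_le_mul_of_nonneg_right hs (Real.exp_pos (n * (2 * M ^ 2 * K ^ 2))).le
          linarith
      _ = _ := by simp

end ExpSup
/-! ### The logistic risk -/

theorem logitLoss_apply {𝒳 : Type*} (f : 𝒳 → ℝ) (x : 𝒳) (y : ℝ) :
    logitLoss f x y = -y * f x + Real.log (1 + Real.exp (f x)) := rfl

theorem measurable_logitLoss {𝒳 : Type*} [MeasurableSpace 𝒳] {f : 𝒳 → ℝ} (hf : Measurable f) :
    Measurable fun z : 𝒳 × ℝ => logitLoss f z.1 z.2 := by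
  unfold logitLoss
  fun_prop

section Prelim
variable {Ω 𝒳 : Type*} [MeasurableSpace Ω] {P : Measure Ω}

theorem L2norm_nonneg (X : Ω → 𝒳) (f : 𝒳 → ℝ) : 0 ≤ L2norm P X f := Real.sqrt_nonneg _

theorem L2norm_sq (X : Ω → 𝒳) (f : 𝒳 → ℝ) : L2norm P X f ^ 2 = ∫ ω, f (X ω) ^ 2 ∂P :=
  Real.sq_sqrt (integral_nonneg fun _ => sq_nonneg _)

theorem L2norm_sub_sq_le {X : Ω → 𝒳} {f g f0 : 𝒳 → ℝ}
    (hf : MemLp (fun ω => (f - f0) (X ω)) 2 P) (hg : MemLp (fun ω => (g - f0) (X ω)) 2 P) :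
    L2norm P X (f - g) ^ 2 ≤ 2 * (L2norm P X (f - f0) ^ 2 + L2norm P X (g - f0) ^ 2) := by
  rw [L2norm_sq, L2norm_sq, L2norm_sq, ← integral_add hf.integrable_sq hg.integrable_sq,
    ← integral_const_mul]
  refine integral_mono_of_nonneg (ae_of_all _ fun _ => sq_nonneg _)
    ((hf.integrable_sq.add hg.integrable_sq).const_mul 2) (ae_of_all _ fun ω => ?_)
  simp only [Pi.sub_apply]
  nlinarith [sq_nonneg ((f (X ω) - f0 (X ω)) + (g (X ω) - f0 (X ω)))]

theorem integrable_log_one_add_exp [IsFiniteMeasure P] {f : Ω → ℝ} (hf : Integrable f P) :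
    Integrable (fun ω => Real.log (1 + Real.exp (f ω))) P := by
  refine ((integrable_const (Real.log 2)).add hf.abs).mono'
    (((Real.measurable_exp.comp_aemeasurable hf.aemeasurable).const_add
      1).log.aestronglyMeasurable) (ae_of_all _ fun ω => ?_)
  -- With `y = 0` and second argument `0`, the Lipschitz bound compares `log (1 + e^u)` with its
  -- value `log 2` at the origin.
  have h := logit_lipschitz (y := 0) (Or.inl rfl) (f ω) 0
  have h0 := Real.log_pos (by norm_num : (1 : ℝ) < 2)
  simp only [neg_zero, zero_mul, zero_add, Real.exp_zero, sub_zero,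
    show (1 : ℝ) + 1 = 2 by norm_num] at h
  have h2 := abs_add_le (Real.log (1 + Real.exp (f ω)) - Real.log 2) (Real.log 2)
  rw [sub_add_cancel, abs_of_pos h0] at h2
  simp only [Real.norm_eq_abs, Pi.add_apply]
  linarith

theorem integrable_logitLoss [IsFiniteMeasure P] {X : Ω → 𝒳} {Y : Ω → ℝ} (hY : Measurable Y)
    (hbin : ∀ ω, Y ω = 0 ∨ Y ω = 1) {f : 𝒳 → ℝ} (hf : Integrable (fun ω => f (X ω)) P) :
    Integrable (fun ω => logitLoss f (X ω) (Y ω)) P := by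
  refine Integrable.add ?_ (integrable_log_one_add_exp hf)
  refine hf.bdd_mul (c := 1) hY.neg.aestronglyMeasurable (ae_of_all _ fun ω => ?_)
  rcases hbin ω with h | h <;> simp [h]

theorem risk_eq_integral [MeasurableSpace 𝒳] {n : ℕ} [NeZero n] {X : Fin n → Ω → 𝒳} {Y : Fin n → Ω → ℝ}
    (hident : ∀ i, IdentDistrib (fun ω => (X i ω, Y i ω)) (fun ω => (X 0 ω, Y 0 ω)) P P)
    {f : 𝒳 → ℝ} (hf : Measurable f) :
    risk P X Y f = ∫ ω, logitLoss f (X 0 ω) (Y 0 ω) ∂P := by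
  have h : ∀ i, ∫ ω, logitLoss f (X i ω) (Y i ω) ∂P = ∫ ω, logitLoss f (X 0 ω) (Y 0 ω) ∂P :=
    fun i => ((hident i).comp (measurable_logitLoss hf)).integral_eq
  have hn : (n : ℝ) ≠ 0 := Nat.cast_ne_zero.2 (NeZero.ne n)
  simp only [risk, h, Finset.sum_const, Finset.card_univ, Fintype.card_fin, nsmul_eq_mul]
  field_simp

theorem coneConst_nonneg {p : ℕ} {lam1 lam2 : ℝ} (h1 : 0 ≤ lam1) (h2 : 0 ≤ lam2)
    (S : Finset (Fin p)) (β : Fin p → ℝ) : 0 ≤ coneConst lam1 lam2 S β := by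
  have := l2_nonneg (restr S β)
  unfold coneConst
  positivity

/-- The infimum is used through this product form, which stays true when the restriction to the
support vanishes and the quotient carries no information. -/
theorem phi_mul_le {p : ℕ} {X : Ω → 𝒳} {ψ : Fin p → 𝒳 → ℝ} {lam1 lam2 : ℝ}
    {β b : Fin p → ℝ}
    (hcone : l1 (restr (supp β)ᶜ b) ≤ coneConst lam1 lam2 (supp β) β * l2 (restr (supp β) b)) :
    phi P X ψ lam1 lam2 β * l2 (restr (supp β) b) ≤ L2norm P X (linComb ψ b) := by
  rcases (l2_nonneg (restr (supp β) b)).eq_or_lt with h0 | hpos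
  · rw [← h0, mul_zero]
    exact L2norm_nonneg _ _
  have hb : b ≠ 0 := by
    rintro rfl
    have : restr (supp β) (0 : Fin p → ℝ) = 0 := by funext j; simp [restr]
    rw [this, l2_eq_zero_iff.2 rfl] at hpos
    exact lt_irrefl _ hpos
  have hbdd : BddBelow {r : ℝ | ∃ b : Fin p → ℝ, b ≠ 0 ∧
      l1 (restr (supp β)ᶜ b) ≤ coneConst lam1 lam2 (supp β) β * l2 (restr (supp β) b) ∧
      r = L2norm P X (linComb ψ b) ^ 2 / l2 (restr (supp β) b) ^ 2} :=
    ⟨0, by rintro r ⟨b, -, -, rfl⟩; positivity⟩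
  have h := Real.sqrt_le_sqrt (csInf_le hbdd ⟨b, hb, hcone, rfl⟩)
  rw [← div_pow, Real.sqrt_sq (div_nonneg (L2norm_nonneg _ _) (l2_nonneg _))] at h
  exact (le_div_iff₀ hpos).1 h

end Prelim

section Risk
variable {Ω 𝒳 : Type*} [MeasurableSpace Ω] [MeasurableSpace 𝒳] {P : Measure Ω}
  [IsProbabilityMeasure P]

/-- The conditional risk given the covariate. -/
theorem integral_logitLoss_eq {X : Ω → 𝒳} {Y : Ω → ℝ} (hX : Measurable X) (hY : Measurable Y)
    (hbin : ∀ ω, Y ω = 0 ∨ Y ω = 1) {π : 𝒳 → ℝ} (hπm : Measurable π) (hπb : ∀ x, |π x| ≤ 1)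
    (hπ : P[Y | MeasurableSpace.comap X inferInstance] =ᵐ[P] fun ω => π (X ω))
    {f : 𝒳 → ℝ} (hf : Measurable f) (hfi : Integrable (fun ω => f (X ω)) P) :
    ∫ ω, logitLoss f (X ω) (Y ω) ∂P =
      ∫ ω, (-π (X ω) * f (X ω) + Real.log (1 + Real.exp (f (X ω)))) ∂P := by
  have hbY : ∀ ω, ‖Y ω‖ ≤ 1 := fun ω => by rcases hbin ω with h | h <;> simp [h]
  have hYi : Integrable Y P := Integrable.of_bound hY.aestronglyMeasurable 1 (ae_of_all _ hbY)
  have hYf : Integrable (fun ω => Y ω * f (X ω)) P :=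
    hfi.bdd_mul (c := 1) hY.aestronglyMeasurable (ae_of_all _ hbY)
  have hπf : Integrable (fun ω => π (X ω) * f (X ω)) P :=
    hfi.bdd_mul (c := 1) (hπm.comp hX).aestronglyMeasurable (ae_of_all _ fun ω => hπb _)
  have hsm : StronglyMeasurable[MeasurableSpace.comap X inferInstance] fun ω => f (X ω) :=
    (hf.comp (comap_measurable X)).stronglyMeasurable
  have hpull := condExp_mul_of_stronglyMeasurable_right hsm hYf hYi
  have key : ∫ ω, Y ω * f (X ω) ∂P = ∫ ω, π (X ω) * f (X ω) ∂P := by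
    rw [← integral_condExp (μ := P) (f := fun ω => Y ω * f (X ω)) hX.comap_le]
    refine integral_congr_ae ?_
    filter_upwards [hpull, hπ] with ω h1 h2
    exact h1.trans (by simp [h2])
  simp only [logitLoss_apply, neg_mul]
  rw [integral_add (f := fun ω => -(Y ω * f (X ω))) hYf.neg (integrable_log_one_add_exp hfi),
    integral_add (f := fun ω => -(π (X ω) * f (X ω))) hπf.neg (integrable_log_one_add_exp hfi),
    integral_neg, integral_neg, key]

/-- The margin condition for the logistic loss. -/
theorem margin_of_logit {n : ℕ} [NeZero n] {X : Fin n → Ω → 𝒳} {Y : Fin n → Ω → ℝ}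
    (hX : Measurable (X 0)) (hY : Measurable (Y 0)) (hbin : ∀ ω, Y 0 ω = 0 ∨ Y 0 ω = 1)
    (hident : ∀ i, IdentDistrib (fun ω => (X i ω, Y i ω)) (fun ω => (X 0 ω, Y 0 ω)) P P)
    {F : Submodule ℝ (𝒳 → ℝ)} (hF : ∀ f ∈ F, Measurable f ∧ MemLp (fun ω => f (X 0 ω)) 2 P)
    {π : 𝒳 → ℝ} (hπ : P[Y 0 | MeasurableSpace.comap (X 0) inferInstance] =ᵐ[P] fun ω => π (X 0 ω))
    (hmodel : ∃ g ∈ F, ∀ x, π x = Real.exp (g x) / (1 + Real.exp (g x)))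
    {ε0 : ℝ} (hε0 : 0 < ε0) (hπε : ∀ x, ε0 ≤ π x ∧ π x ≤ 1 - ε0)
    {f0 : 𝒳 → ℝ} (hf0 : IsTarget P X Y F f0) {η : ℝ} {f : 𝒳 → ℝ} (hf : f ∈ Flocal F f0 η) :
    marginConst ε0 η * L2norm P (X 0) (f - f0) ^ 2 ≤ excessRisk P X Y f0 f := by
  obtain ⟨g, hgF, hg⟩ := hmodel
  have hgm := (hF g hgF).1
  have hπm : Measurable π := by
    rw [funext hg]
    fun_prop
  have hint : ∀ f ∈ F, Integrable (fun ω => f (X 0 ω)) P := fun f hf =>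
    (hF f hf).2.integrable one_le_two
  set κ : (𝒳 → ℝ) → Ω → ℝ := fun f ω =>
    -π (X 0 ω) * f (X 0 ω) + Real.log (1 + Real.exp (f (X 0 ω))) with hκ
  have hπb : ∀ x, |π x| ≤ 1 := fun x => by
    rw [abs_le]; constructor <;> linarith [(hπε x).1, (hπε x).2]
  have hrisk : ∀ f ∈ F, risk P X Y f = ∫ ω, κ f ω ∂P := fun f hf => by
    rw [risk_eq_integral hident (hF f hf).1]
    exact integral_logitLoss_eq hX hY hbin hπm hπb hπ (hF f hf).1 (hint f hf)
  have hκi : ∀ f ∈ F, Integrable (κ f) P := fun f hf => by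
    refine Integrable.add ?_ (integrable_log_one_add_exp (hint f hf))
    refine (hint f hf).bdd_mul (c := 1) (hπm.comp hX).neg.aestronglyMeasurable
      (ae_of_all _ fun ω => ?_)
    rw [norm_neg]
    exact hπb _
  have hquad : ∀ (f : 𝒳 → ℝ) (η : ℝ) ω, |f (X 0 ω) - g (X 0 ω)| ≤ η →
      marginConst ε0 η * (f (X 0 ω) - g (X 0 ω)) ^ 2 ≤ κ f ω - κ g ω := fun f η ω h => by
    have h1 := hπε (X 0 ω)
    rw [hg] at h1
    have := quadratic_lower_bound hε0 h1.1 h1.2 h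
    simpa only [hκ, hg] using this
  -- the target coincides with the logit of `π`
  have htarget : ∀ᵐ ω ∂P, f0 (X 0 ω) = g (X 0 ω) := by
    -- The quadratic bound is applied with the radius `|f⁰ - g|` at the given outcome, since no
    -- bound on `f⁰ - g` is available beforehand. Only the positivity of the resulting constant
    -- matters: the nonnegative integrand has integral zero by minimality, so it vanishes almost
    -- surely.
    have hnn : 0 ≤ᵐ[P] fun ω => κ f0 ω - κ g ω := ae_of_all _ fun ω =>
      (mul_nonneg (marginConst_pos hε0).le (sq_nonneg _)).trans (hquad f0 _ ω le_rfl)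
    have hz : ∫ ω, (κ f0 ω - κ g ω) ∂P = 0 := by
      refine le_antisymm ?_ (integral_nonneg_of_ae hnn)
      rw [integral_sub (hκi _ hf0.1) (hκi _ hgF), ← hrisk _ hf0.1, ← hrisk _ hgF]
      linarith [hf0.2 g hgF]
    rw [integral_eq_zero_iff_of_nonneg_ae hnn ((hκi _ hf0.1).sub (hκi _ hgF))] at hz
    filter_upwards [hz] with ω hω
    have h1 := hquad f0 _ ω le_rfl
    simp only [Pi.zero_apply] at hω
    rw [hω] at h1
    have h2 := marginConst_pos (η := |f0 (X 0 ω) - g (X 0 ω)|) hε0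
    have h3 : (f0 (X 0 ω) - g (X 0 ω)) ^ 2 = 0 :=
      le_antisymm (nonpos_of_mul_nonpos_right h1 h2) (sq_nonneg _)
    exact sub_eq_zero.1 (pow_eq_zero_iff two_ne_zero |>.1 h3)
  have hsq : Integrable (fun ω => (f - f0) (X 0 ω) ^ 2) P :=
    (hF _ (F.sub_mem hf.1 hf0.1)).2.integrable_sq
  rw [L2norm, Real.sq_sqrt (integral_nonneg fun _ => sq_nonneg _), excessRisk, hrisk _ hf.1,
    hrisk _ hf0.1, ← integral_sub (hκi _ hf.1) (hκi _ hf0.1), ← integral_const_mul]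
  refine integral_mono_ae (hsq.const_mul _) ((hκi _ hf.1).sub (hκi _ hf0.1)) ?_
  filter_upwards [htarget] with ω hω
  have hη := hf.2 (X 0 ω)
  have e : κ f0 ω = κ g ω := by simp only [hκ, hω]
  simp only [Pi.sub_apply, hω] at hη ⊢
  rw [e]
  exact hquad f η ω hη

/-! ### The restricted eigenvalue -/

theorem measurable_linComb {p : ℕ} {ψ : Fin p → 𝒳 → ℝ} (hψ : ∀ j, Measurable (ψ j))
    (b : Fin p → ℝ) : Measurable (linComb ψ b) :=
  Finset.measurable_fun_sum _ fun j _ => (hψ j).const_mul _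

/-- Full rank makes `Σ` invertible, so `b = Σ⁻¹ (Σ b)`. Each coordinate `(Σ b)_j = E ψ_j f_b` is at
most `K ‖f_b‖`, and Cauchy–Schwarz along the rows of `Σ⁻¹` bounds `‖b‖₂` by a multiple of `‖f_b‖`.
-/
theorem exists_l2_sq_le_of_rank {p : ℕ} {X : Ω → 𝒳} (hX : Measurable X) {ψ : Fin p → 𝒳 → ℝ}
    (hψ : ∀ j, Measurable (ψ j)) {K : ℝ} (hψK : ∀ j, SupNormLE (ψ j) K)
    (hrank : (gram P X ψ).rank = p) :
    ∃ κ : ℝ, 0 < κ ∧ ∀ b : Fin p → ℝ, κ * l2 b ^ 2 ≤ L2norm P X (linComb ψ b) ^ 2 := by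
  set A := gram P X ψ with hA
  have hinj : ∀ b : Fin p → ℝ, (A⁻¹).mulVec (A.mulVec b) = b := by
    have hu : IsUnit A := by
      rw [← Matrix.mulVec_surjective_iff_isUnit]
      have h : LinearMap.range A.mulVecLin = ⊤ := by
        apply Submodule.eq_top_of_finrank_eq
        rw [← Matrix.rank, hrank]
        simp
      exact LinearMap.range_eq_top.1 h
    intro b
    rw [Matrix.mulVec_mulVec, Matrix.nonsing_inv_mul _ ((Matrix.isUnit_iff_isUnit_det _).1 hu),
      Matrix.one_mulVec]
  have hmulVec : ∀ b j, (A.mulVec b j) ^ 2 ≤ K ^ 2 * L2norm P X (linComb ψ b) ^ 2 := by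
    intro b j
    have hbm := measurable_linComb hψ b
    have e : A.mulVec b j = ∫ ω, ψ j (X ω) * linComb ψ b (X ω) ∂P := by
      have hi : ∀ k, Integrable (fun ω => ψ j (X ω) * ψ k (X ω)) P := fun k =>
        Integrable.of_bound (((hψ j).comp hX).mul ((hψ k).comp hX)).aestronglyMeasurable (K * K)
          (ae_of_all _ fun ω => by
            rw [norm_mul]
            exact mul_le_mul (hψK j _) (hψK k _) (norm_nonneg _)
              ((abs_nonneg _).trans (hψK j (X ω))))
      have e1 : ∀ ω, ψ j (X ω) * linComb ψ b (X ω) = ∑ k, ψ j (X ω) * ψ k (X ω) * b k :=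
        fun ω => by
          rw [linComb, Finset.mul_sum]
          exact Finset.sum_congr rfl fun k _ => by ring
      simp only [e1]
      rw [integral_finsetSum _ fun k _ => (hi k).mul_const _]
      simp only [integral_mul_const]
      rfl
    have hLp : MemLp (fun ω => ψ j (X ω) * linComb ψ b (X ω)) 2 P :=
      MemLp.of_bound (((hψ j).comp hX).mul (hbm.comp hX)).aestronglyMeasurable
        (K * (l1 b * K)) (ae_of_all _ fun ω => by
          rw [norm_mul]
          exact mul_le_mul (hψK j _) (abs_linComb_le hψK b _) (norm_nonneg _)
            ((abs_nonneg _).trans (hψK j (X ω))))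
    have hbLp : MemLp (fun ω => linComb ψ b (X ω)) 2 P :=
      MemLp.of_bound (hbm.comp hX).aestronglyMeasurable (l1 b * K)
        (ae_of_all _ fun ω => abs_linComb_le hψK b _)
    -- Nonnegativity of the variance supplies `(E Z)² ≤ E Z²`.
    have hv := variance_nonneg (fun ω => ψ j (X ω) * linComb ψ b (X ω)) P
    rw [variance_eq_sub hLp] at hv
    rw [e, L2norm_sq, ← integral_const_mul]
    refine (sub_nonneg.1 hv).trans
      (integral_mono hLp.integrable_sq (hbLp.integrable_sq.const_mul _) fun ω => ?_)
    simp only [Pi.pow_apply, mul_pow]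
    exact mul_le_mul_of_nonneg_right
      (sq_le_sq' (abs_le.1 (hψK j _)).1 (abs_le.1 (hψK j _)).2) (sq_nonneg _)
  set D : ℝ := (∑ i, ∑ k, A⁻¹ i k ^ 2) * (p * K ^ 2) with hD
  have hDnn : 0 ≤ D := by positivity
  have hle : ∀ b, l2 b ^ 2 ≤ D * L2norm P X (linComb ψ b) ^ 2 := by
    intro b
    rw [l2_sq, hD, mul_assoc, Finset.sum_mul]
    refine Finset.sum_le_sum fun i _ => ?_
    have h1 : b i = ∑ k, A⁻¹ i k * A.mulVec b k := (congrFun (hinj b) i).symm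
    rw [h1]
    refine (Finset.sum_mul_sq_le_sq_mul_sq _ _ _).trans ?_
    refine mul_le_mul_of_nonneg_left ?_ (Finset.sum_nonneg fun _ _ => sq_nonneg _)
    refine (Finset.sum_le_sum fun k _ => hmulVec b k).trans (le_of_eq ?_)
    simp
    ring
  -- Adding 1 keeps the constant well defined and positive when `D = 0`.
  refine ⟨1 / (D + 1), by positivity, fun b => ?_⟩
  rw [div_mul_eq_mul_div, one_mul, div_le_iff₀ (by positivity)]
  have := hle b
  nlinarith [sq_nonneg (L2norm P X (linComb ψ b))]

theorem phi_pos {p : ℕ} {X : Ω → 𝒳} (hX : Measurable X) {ψ : Fin p → 𝒳 → ℝ}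
    (hψ : ∀ j, Measurable (ψ j)) {K : ℝ} (hψK : ∀ j, SupNormLE (ψ j) K)
    (hrank : (gram P X ψ).rank = p) {lam1 lam2 : ℝ} (h1 : 0 ≤ lam1) (h2 : 0 ≤ lam2)
    {β : Fin p → ℝ} (hβ : β ≠ 0) : 0 < phi P X ψ lam1 lam2 β := by
  obtain ⟨κ, hκ, hlow⟩ := exists_l2_sq_le_of_rank hX hψ hψK hrank
  -- Nonemptiness has to be shown, as the real infimum of the empty set is 0; `β` itself lies in the
  -- cone, having no mass off its support. A nonzero `b` in the cone cannot vanish on the support,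
  -- so `κ ‖b‖₂² ≥ κ ‖b_S‖₂²` bounds every quotient below by `κ`.
  refine Real.sqrt_pos.2 (hκ.trans_le (le_csInf ⟨_, β, hβ, ?_, rfl⟩ ?_))
  · have : restr (supp β)ᶜ β = 0 := by
      funext j
      by_cases h : β j = 0 <;> simp [restr, supp, h]
    rw [this]
    refine le_trans (le_of_eq (by simp [l1])) (mul_nonneg (coneConst_nonneg h1 h2 _ _) (l2_nonneg _))
  · rintro r ⟨b, hb, hcone, rfl⟩
    have hpos : 0 < l2 (restr (supp β) b) := by
      refine l2_pos fun h0 => hb ?_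
      rw [h0, l2_eq_zero_iff.2 rfl, mul_zero] at hcone
      have hl1 := l1_restr_add_restr_compl (supp β) b
      rw [h0] at hl1
      have hz : l1 b ≤ 0 := by
        rw [hl1]
        simpa [l1] using hcone
      funext j
      have := (Finset.single_le_sum (f := fun j => |b j|) (fun _ _ => abs_nonneg _)
        (Finset.mem_univ j)).trans hz
      exact abs_nonpos_iff.1 this
    rw [le_div_iff₀ (by positivity)]
    exact (mul_le_mul_of_nonneg_left (l2_restr_le _ _) hκ.le).trans (hlow b)

end Risk
/-! ### The empirical process -/

theorem Vn_eq {Ω 𝒳 : Type*} [MeasurableSpace Ω] {P : Measure Ω} {n p : ℕ} {X : Fin n → Ω → 𝒳}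
    {Y : Fin n → Ω → ℝ} {ψ : Fin p → 𝒳 → ℝ} (β : Fin p → ℝ) (ω : Ω) :
    Vn P X Y ψ β ω = empRisk X Y (linComb ψ β) ω - risk P X Y (linComb ψ β) := by
  rw [Vn, empRisk, risk, Finset.sum_sub_distrib, mul_sub]

section EmpiricalProc
variable {Ω 𝒳 : Type*} [MeasurableSpace Ω] [MeasurableSpace 𝒳] {P : Measure Ω}
  [IsProbabilityMeasure P] {n p : ℕ} {X : Fin n → Ω → 𝒳} {Y : Fin n → Ω → ℝ}
  {ψ : Fin p → 𝒳 → ℝ} {K : ℝ}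

theorem integrable_logitLoss_linComb (hX : ∀ i, Measurable (X i)) (hY : ∀ i, Measurable (Y i))
    (hbin : ∀ i ω, Y i ω = 0 ∨ Y i ω = 1) (hψ : ∀ j, Measurable (ψ j))
    (hψK : ∀ j, SupNormLE (ψ j) K) (β : Fin p → ℝ) (i : Fin n) :
    Integrable (fun ω => logitLoss (linComb ψ β) (X i ω) (Y i ω)) P :=
  integrable_logitLoss (hY i) (hbin i) <|
    Integrable.of_bound ((measurable_linComb hψ β).comp (hX i)).aestronglyMeasurable (l1 β * K)
      (ae_of_all _ fun _ => abs_linComb_le hψK _ _)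

/-- The factor 2 counts the loss and its expectation. This crude bound makes the local supremum
finite and the process continuous in the coefficients. -/
theorem Vn_lipschitz [NeZero n] (hX : ∀ i, Measurable (X i)) (hY : ∀ i, Measurable (Y i))
    (hbin : ∀ i ω, Y i ω = 0 ∨ Y i ω = 1) (hψ : ∀ j, Measurable (ψ j))
    (hψK : ∀ j, SupNormLE (ψ j) K) (β β' : Fin p → ℝ) (ω : Ω) :
    |Vn P X Y ψ β ω - Vn P X Y ψ β' ω| ≤ 2 * K * l1 (β - β') := by
  have hl : ∀ i ω, |logitLoss (linComb ψ β) (X i ω) (Y i ω) -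
      logitLoss (linComb ψ β') (X i ω) (Y i ω)| ≤ l1 (β - β') * K := fun i ω => by
    refine (logit_lipschitz (hbin i ω) _ _).trans ?_
    have := abs_linComb_le hψK (β - β') (X i ω)
    rwa [linComb_sub] at this
  have hi := integrable_logitLoss_linComb (P := P) hX hY hbin hψ hψK
  have hE : ∀ i, |(∫ ω, logitLoss (linComb ψ β) (X i ω) (Y i ω) ∂P) -
      ∫ ω, logitLoss (linComb ψ β') (X i ω) (Y i ω) ∂P| ≤ l1 (β - β') * K := fun i => by
    rw [← integral_sub (hi β i) (hi β' i)]
    have := norm_integral_le_of_norm_le_const (μ := P)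
      (f := fun ω => logitLoss (linComb ψ β) (X i ω) (Y i ω) -
        logitLoss (linComb ψ β') (X i ω) (Y i ω)) (ae_of_all _ (hl i))
    simpa using this
  have hn : (0 : ℝ) < n := Nat.cast_pos.2 (NeZero.pos n)
  rw [Vn, Vn, ← mul_sub, ← Finset.sum_sub_distrib, abs_mul, abs_of_pos (by positivity)]
  have h : |∑ i, ((logitLoss (linComb ψ β) (X i ω) (Y i ω) -
      ∫ ω, logitLoss (linComb ψ β) (X i ω) (Y i ω) ∂P) -
      (logitLoss (linComb ψ β') (X i ω) (Y i ω) -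
      ∫ ω, logitLoss (linComb ψ β') (X i ω) (Y i ω) ∂P))| ≤
      ∑ _i : Fin n, 2 * (l1 (β - β') * K) := by
    refine (Finset.abs_sum_le_sum_abs _ _).trans (Finset.sum_le_sum fun i _ => ?_)
    have h1 := abs_le.1 (hl i ω)
    have h2 := abs_le.1 (hE i)
    rw [abs_le]
    constructor <;> linarith [h1.1, h1.2, h2.1, h2.2]
  rw [Finset.sum_const, Finset.card_univ, Fintype.card_fin, nsmul_eq_mul] at h
  rw [div_mul_eq_mul_div, one_mul, div_le_iff₀ hn]
  linarith

theorem Vn_sub_Vn_le_ZM [NeZero n] (hX : ∀ i, Measurable (X i)) (hY : ∀ i, Measurable (Y i))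
    (hbin : ∀ i ω, Y i ω = 0 ∨ Y i ω = 1) (hψ : ∀ j, Measurable (ψ j)) (hK : 0 ≤ K)
    (hψK : ∀ j, SupNormLE (ψ j) K) {β βs : Fin p → ℝ} {M : ℝ} (hβ : l1 (β - βs) ≤ M) (ω : Ω) :
    |Vn P X Y ψ β ω - Vn P X Y ψ βs ω| ≤ ZM P X Y ψ βs M ω := by
  refine le_csSup ⟨2 * K * M, ?_⟩ ⟨β, hβ, rfl⟩
  rintro _ ⟨b, hb, rfl⟩
  exact (Vn_lipschitz hX hY hbin hψ hψK b βs ω).trans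
    (mul_le_mul_of_nonneg_left hb (by positivity))

/-- Chernoff's bound for one sign `σ` of the process. The moment bound is used with `w = 0`, where
each coordinate contributes `1 + 1`; hence the factor `2p`. -/
theorem tail_bound_finite [NeZero n] [NeZero p] (hX : ∀ i, Measurable (X i))
    (hY : ∀ i, Measurable (Y i)) (hbin : ∀ i ω, Y i ω = 0 ∨ Y i ω = 1)
    (hindep : iIndepFun (fun i ω => (X i ω, Y i ω)) P)
    (hident : ∀ i, IdentDistrib (fun ω => (X i ω, Y i ω)) (fun ω => (X 0 ω, Y 0 ω)) P P)
    (hψ : ∀ j, Measurable (ψ j)) (hK : 0 < K) (hψK : ∀ j, SupNormLE (ψ j) K)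
    {ι : Type*} [Fintype ι] [Nonempty ι] {βs : Fin p → ℝ} {D : ι → Fin p → ℝ} {M : ℝ} (hM : 0 < M)
    (hD : ∀ i, l1 (D i) ≤ M) {σ : ℝ} (hσ : |σ| = 1) {t : ℝ} (ht : 0 ≤ t) :
    P.real {ω | ∃ i, t < σ * (Vn P X Y ψ (βs + D i) ω - Vn P X Y ψ βs ω)} ≤
      2 * p * Real.exp (-(n * t ^ 2 / (8 * M ^ 2 * K ^ 2))) := by
  have hn : (0 : ℝ) < n := Nat.cast_pos.2 (NeZero.pos n)
  -- This value minimizes `2θ²M²K² - θt`, the exponent per observation, with minimum `-t² /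
  -- (8M²K²)`.
  set θ : ℝ := t / (4 * M ^ 2 * K ^ 2) with hθ
  have hθ0 : 0 ≤ θ := by positivity
  set W : Fin n → Ω → 𝒳 × ℝ := fun i ω => (X i ω, Y i ω) with hW
  have hWm : ∀ i, Measurable (W i) := fun i => (hX i).prodMk (hY i)
  set μ : Measure (𝒳 × ℝ) := P.map (W 0) with hμ
  have : IsProbabilityMeasure μ := Measure.isProbabilityMeasure_map (hWm 0).aemeasurable
  -- a version of the loss with binary responses everywhere
  set y : ℝ → ℝ := fun s => if s = 0 then 0 else 1 with hy
  have hym : Measurable y := Measurable.ite (measurableSet_singleton 0) measurable_const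
    measurable_const
  have hybin : ∀ s, y s = 0 ∨ y s = 1 := fun s => by by_cases h : s = 0 <;> simp [hy, h]
  have hyY : ∀ i ω, y (Y i ω) = Y i ω := fun i ω => by
    rcases hbin i ω with h | h <;> simp [hy, h]
  set ℓ : (Fin p → ℝ) → 𝒳 × ℝ → ℝ := fun β z => logitLoss (linComb ψ β) z.1 (y z.2) with hℓ
  have hℓm : ∀ β, Measurable (ℓ β) := fun β =>
    (measurable_logitLoss (measurable_linComb hψ β)).comp
      (measurable_fst.prodMk (hym.comp measurable_snd))
  have hℓlip : ∀ β β' z, |ℓ β z - ℓ β' z| ≤ |linComb ψ β z.1 - linComb ψ β' z.1| :=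
    fun β β' z => logit_lipschitz (hybin _) _ _
  have hℓW : ∀ β i ω, ℓ β (W i ω) = logitLoss (linComb ψ β) (X i ω) (Y i ω) := fun β i ω => by
    simp only [hℓ, hW, hyY]
  set h : ι → 𝒳 × ℝ → ℝ := fun i z => σ * θ * (ℓ (βs + D i) z - ℓ βs z) with hh
  have hhm : ∀ i, Measurable (h i) := fun i => ((hℓm _).sub (hℓm _)).const_mul _
  set Ψ : Fin p → 𝒳 × ℝ → ℝ := fun j z => ψ j z.1 with hΨ
  set b : ι → Fin p → ℝ := fun i => θ • D i with hb
  have hlin : ∀ i z, linComb Ψ (b i) z = θ * linComb ψ (D i) z.1 := fun i z => by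
    simp only [linComb, hΨ, hb, Pi.smul_apply, smul_eq_mul, Finset.mul_sum]
    exact Finset.sum_congr rfl fun j _ => by ring
  have hadd : ∀ i x, linComb ψ (βs + D i) x = linComb ψ βs x + linComb ψ (D i) x := fun i x => by
    simp [linComb, add_mul, Finset.sum_add_distrib]
  have hσθ : |σ * θ| = θ := by rw [abs_mul, hσ, one_mul, abs_of_nonneg hθ0]
  have hlip : ∀ i k z, |h i z - h k z| ≤ |linComb Ψ (b i) z - linComb Ψ (b k) z| := by
    intro i k z
    rw [hlin, hlin, ← mul_sub θ, abs_mul θ, abs_of_nonneg hθ0,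
      show h i z - h k z = σ * θ * (ℓ (βs + D i) z - ℓ (βs + D k) z) by simp only [hh]; ring,
      abs_mul, hσθ]
    refine mul_le_mul_of_nonneg_left ((hℓlip _ _ z).trans (le_of_eq ?_)) hθ0
    rw [hadd, hadd]
    ring_nf
  have hle : ∀ i z, |h i z| ≤ |linComb Ψ (b i) z| := by
    intro i z
    rw [hlin, abs_mul θ, abs_of_nonneg hθ0, abs_mul, hσθ]
    refine mul_le_mul_of_nonneg_left ((hℓlip _ _ z).trans (le_of_eq ?_)) hθ0
    rw [hadd]
    ring_nf
  have hbM : ∀ i, l1 (b i) ≤ θ * M := fun i => by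
    rw [hb, l1_smul, abs_of_nonneg hθ0]
    exact mul_le_mul_of_nonneg_left (hD i) hθ0
  have hΨK : ∀ j z, |Ψ j z| ≤ K := fun j z => hψK j z.1
  have hmoment := integral_expSup_pi_le μ (fun j => (hψ j).comp measurable_fst) hK.le hΨK hbM hhm
    hlip hle n 0
  -- transfer to the sample
  have hlaw : P.map (fun ω i => W i ω) = Measure.pi fun _ => μ := by
    rw [(iIndepFun_iff_map_fun_eq_pi_map fun i => (hWm i).aemeasurable).1 hindep]
    congr 1
    funext i
    exact (hident i).map_eq
  have hhB : ∀ i z, h i z ≤ θ * M * K := fun i z =>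
    (le_abs_self _).trans ((hle i z).trans ((abs_linComb_le hΨK _ _).trans
      (mul_le_mul_of_nonneg_right (hbM i) hK.le)))
  set m : ι → ℝ := fun i => ∫ z, h i z ∂μ with hm
  set g : (Fin n → 𝒳 × ℝ) → ℝ := fun z =>
    expSup fun i => ∑ j, b i j * (0 : Fin p → ℝ) j + ∑ k, (h i (z k) - m i) with hg
  have hgi : Integrable g (Measure.pi fun _ => μ) :=
    integrable_expSup (fun i => by
      refine Measurable.const_add (Finset.measurable_fun_sum _ fun k _ => ?_) _
      exact ((hhm i).comp (measurable_pi_apply k)).sub_const _)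
      (C := fun i => ∑ j, b i j * (0 : Fin p → ℝ) j + ∑ _k : Fin n, (θ * M * K - m i))
      fun i z => add_le_add le_rfl (Finset.sum_le_sum fun k _ => sub_le_sub_right (hhB i _) _)
  have hWall : AEMeasurable (fun ω i => W i ω) P := (measurable_pi_lambda _ hWm).aemeasurable
  have hgW : ∫ ω, g (fun i => W i ω) ∂P = ∫ z, g z ∂(Measure.pi fun _ => μ) := by
    rw [← hlaw, integral_map hWall (by rw [hlaw]; exact hgi.aestronglyMeasurable)]
  have hgWi : Integrable (fun ω => g fun i => W i ω) P := by
    rw [← hlaw] at hgi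
    exact hgi.comp_aemeasurable hWall
  -- The factor `θ n` cancels the normalization `1/n`, so the scaled process is exactly the centered
  -- sum in the moment bound.
  have hVn : ∀ i ω, θ * n * (σ * (Vn P X Y ψ (βs + D i) ω - Vn P X Y ψ βs ω)) =
      ∑ j, b i j * (0 : Fin p → ℝ) j + ∑ k, (h i (W k ω) - m i) := by
    intro i ω
    have hi := integrable_logitLoss_linComb (P := P) hX hY hbin hψ hψK
    have e : ∀ k, m i = σ * θ * ((∫ ω, logitLoss (linComb ψ (βs + D i)) (X k ω) (Y k ω) ∂P) -
        ∫ ω, logitLoss (linComb ψ βs) (X k ω) (Y k ω) ∂P) := by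
      intro k
      rw [← integral_sub (hi _ k) (hi _ k), ← integral_const_mul, hm, hμ, ← (hident k).map_eq]
      simp only
      rw [integral_map (hWm k).aemeasurable (hhm i).aestronglyMeasurable]
      simp only [hh, ← hℓW]
    simp only [Pi.zero_apply, mul_zero, Finset.sum_const_zero, zero_add]
    rw [Vn, Vn, ← mul_sub, ← Finset.sum_sub_distrib,
      show ∀ q : ℝ, θ * n * (σ * (1 / (n : ℝ) * q)) = σ * θ * q by intro q; field_simp,
      Finset.mul_sum]
    refine Finset.sum_congr rfl fun k _ => ?_
    rw [e k]
    simp only [hh, hℓW]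
    ring
  have hmarkov := mul_meas_ge_le_integral_of_nonneg (μ := P)
    (ae_of_all _ fun ω => expSup_nonneg _) hgWi (Real.exp (θ * n * t))
  have hsub : {ω | ∃ i, t < σ * (Vn P X Y ψ (βs + D i) ω - Vn P X Y ψ βs ω)} ⊆
      {ω | Real.exp (θ * n * t) ≤ g fun i => W i ω} := by
    rintro ω ⟨i, hi⟩
    refine le_trans (Real.exp_le_exp.2 ?_) (le_expSup _ i)
    rw [← hVn]
    exact mul_le_mul_of_nonneg_left hi.le (by positivity)
  have hfin : P.real {ω | Real.exp (θ * n * t) ≤ g fun i => W i ω} ≤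
      2 * p * Real.exp (-(n * t ^ 2 / (8 * M ^ 2 * K ^ 2))) := by
    rw [hgW] at hmarkov
    have h1 := hmarkov.trans hmoment
    rw [mul_comm, ← le_div_iff₀ (Real.exp_pos _)] at h1
    refine h1.trans (le_of_eq ?_)
    simp only [Pi.zero_apply, mul_zero, neg_zero, Real.exp_zero, Finset.sum_const,
      Finset.card_univ, Fintype.card_fin, nsmul_eq_mul]
    rw [mul_div_assoc, ← Real.exp_sub]
    have : (n : ℝ) * (2 * (θ * M) ^ 2 * K ^ 2) - θ * n * t =
        -(n * t ^ 2 / (8 * M ^ 2 * K ^ 2)) := by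
      rw [hθ]
      field_simp
      ring
    rw [this]
    ring
  exact (measureReal_mono hsub).trans hfin

/-- By continuity in the coefficients, the supremum exceeds `t` only if some point of a countable
dense subset of the ball does. The events for the first `N + 1` points increase with `N`, so the
uniform finite bound passes to the union; the two signs turn `2p` into `4p`. -/
theorem tail_bound_ZM [NeZero n] [NeZero p] (hX : ∀ i, Measurable (X i))
    (hY : ∀ i, Measurable (Y i)) (hbin : ∀ i ω, Y i ω = 0 ∨ Y i ω = 1)
    (hindep : iIndepFun (fun i ω => (X i ω, Y i ω)) P)
    (hident : ∀ i, IdentDistrib (fun ω => (X i ω, Y i ω)) (fun ω => (X 0 ω, Y 0 ω)) P P)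
    (hψ : ∀ j, Measurable (ψ j)) (hK : 0 < K) (hψK : ∀ j, SupNormLE (ψ j) K)
    {βs : Fin p → ℝ} {M : ℝ} (hM : 0 < M) {t : ℝ} (ht : 0 ≤ t) :
    P.real {ω | t < ZM P X Y ψ βs M ω} ≤
      4 * p * Real.exp (-(n * t ^ 2 / (8 * M ^ 2 * K ^ 2))) := by
  set bound : ℝ := 4 * p * Real.exp (-(n * t ^ 2 / (8 * M ^ 2 * K ^ 2))) with hbound
  have hl1cont : Continuous fun v : Fin p → ℝ => l1 v := by unfold l1; fun_prop
  let B : Set (Fin p → ℝ) := {v | l1 v ≤ M}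
  have hB0 : (0 : Fin p → ℝ) ∈ B := by simp [B, l1, hM.le]
  have : Nonempty B := ⟨⟨0, hB0⟩⟩
  set D : ℕ → B := TopologicalSpace.denseSeq B with hD
  set q : (Fin p → ℝ) → Ω → ℝ := fun v ω => Vn P X Y ψ (βs + v) ω - Vn P X Y ψ βs ω with hq
  have hqc : ∀ ω, Continuous fun v => q v ω := by
    intro ω
    rw [continuous_iff_continuousAt]
    intro v
    refine tendsto_iff_dist_tendsto_zero.2 (squeeze_zero (fun _ => dist_nonneg)
      (g := fun v' => 2 * K * l1 (v' - v)) (fun v' => ?_) ?_)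
    · have := Vn_lipschitz (P := P) hX hY hbin hψ hψK (βs + v') (βs + v) ω
      rw [add_sub_add_left_eq_sub] at this
      simpa [hq, Real.dist_eq] using this
    · have : Continuous fun v' => 2 * K * l1 (v' - v) :=
        continuous_const.mul (hl1cont.comp (continuous_id.sub continuous_const))
      have h0 := this.tendsto v
      simpa [l1] using h0
  set E : ℕ → Set Ω := fun N => {ω | ∃ i : Fin (N + 1), t < |q (D i) ω|} with hE
  have hEmono : Monotone E := by
    rintro N N' hN ω ⟨i, hi⟩
    exact ⟨⟨i, by have := i.2; omega⟩, hi⟩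
  have hEbound : ∀ N, P.real (E N) ≤ bound := by
    intro N
    have hDM : ∀ i : Fin (N + 1), l1 (D i : Fin p → ℝ) ≤ M := fun i => (D i).2
    have b1 := tail_bound_finite (P := P) hX hY hbin hindep hident hψ hK hψK (βs := βs) hM hDM
      (σ := 1) (by simp) ht
    have b2 := tail_bound_finite (P := P) hX hY hbin hindep hident hψ hK hψK (βs := βs) hM hDM
      (σ := -1) (by simp) ht
    refine (measureReal_mono ?_).trans ((measureReal_union_le _ _).trans
      ((add_le_add b1 b2).trans (le_of_eq (by rw [hbound]; ring))))
    rintro ω ⟨i, hi⟩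
    rcases lt_abs.1 hi with h | h
    · exact Or.inl ⟨i, by simpa [hq] using h⟩
    · exact Or.inr ⟨i, by simpa [hq] using h⟩
  have hsub : {ω | t < ZM P X Y ψ βs M ω} ⊆ ⋃ N, E N := by
    intro ω (hω : t < ZM P X Y ψ βs M ω)
    rw [ZM] at hω
    have hne : {β : Fin p → ℝ | l1 (β - βs) ≤ M}.Nonempty := ⟨βs, by simp [l1, hM.le]⟩
    obtain ⟨_, ⟨β, hβ, rfl⟩, hlt⟩ := exists_lt_of_lt_csSup (hne.image _) hω
    -- Strictness of the inequality makes the set of good points open in the ball, so it meets the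
    -- dense sequence.
    have hopen : IsOpen {v : B | t < |q v ω|} :=
      isOpen_lt continuous_const ((hqc ω).comp continuous_subtype_val).abs
    obtain ⟨N, hN⟩ := (TopologicalSpace.denseRange_denseSeq B).exists_mem_open hopen
      ⟨⟨β - βs, hβ⟩, by simpa [hq] using hlt⟩
    exact Set.mem_iUnion.2 ⟨N, ⟨N, by omega⟩, hN⟩
  refine (measureReal_mono hsub).trans ?_
  rw [measureReal_def, hEmono.measure_iUnion]
  refine ENNReal.toReal_le_of_le_ofReal (by positivity) (iSup_le fun N => ?_)
  rw [← ofReal_measureReal]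
  exact ENNReal.ofReal_le_ofReal (hEbound N)

end EmpiricalProc
/-! ### The oracle inequality -/

/-- The basic inequality, along the segment between the oracle and the estimator. -/
theorem IsElasticNet.segment_le {Ω 𝒳 : Type*} {n p : ℕ} {X : Fin n → Ω → 𝒳} {Y : Fin n → Ω → ℝ}
    {ψ : Fin p → 𝒳 → ℝ} {Φ : Set (Fin p → ℝ)} {lam1 lam2 : ℝ} (h1 : 0 ≤ lam1) (h2 : 0 ≤ lam2)
    {ω : Ω} {bh β : Fin p → ℝ} (hbh : IsElasticNet X Y ψ Φ lam1 lam2 ω bh)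
    (hβ : β ∈ Φ) {s t : ℝ} (hs : 0 ≤ s) (ht : 0 ≤ t) (hst : s + t = 1) :
    empRisk X Y (linComb ψ (s • bh + t • β)) ω + lam1 * l1 (s • bh + t • β) +
        lam2 * l2 (s • bh + t • β) ^ 2 ≤
      empRisk X Y (linComb ψ β) ω + lam1 * l1 β + lam2 * l2 β ^ 2 := by
  have hrisk : empRisk X Y (linComb ψ (s • bh + t • β)) ω ≤
      s * empRisk X Y (linComb ψ bh) ω + t * empRisk X Y (linComb ψ β) ω := by
    rw [empRisk, empRisk, empRisk, mul_left_comm s, mul_left_comm t, ← mul_add, Finset.mul_sum _ _ s,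
      Finset.mul_sum _ _ t, ← Finset.sum_add_distrib]
    refine mul_le_mul_of_nonneg_left (Finset.sum_le_sum fun i _ => ?_) (by positivity)
    rw [logitLoss_apply, linComb_convex]
    exact logitLoss_convex hs ht hst
  have hpen := penalty_convex h1 h2 hs ht hst bh β
  have hmin := mul_le_mul_of_nonneg_left (hbh.2 β hβ) hs
  obtain rfl : t = 1 - s := by linarith
  linarith

section Oracle
variable {Ω 𝒳 : Type*} [MeasurableSpace Ω] {P : Measure Ω}
  {n p : ℕ} [NeZero n] {X : Fin n → Ω → 𝒳} {Y : Fin n → Ω → ℝ} {ψ : Fin p → 𝒳 → ℝ}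
  {f0 : 𝒳 → ℝ} {c lam1 lam2 : ℝ} {βs : Fin p → ℝ}

/-- From the basic inequality to the oracle inequality, for vectors close to the oracle. -/
theorem oracle_bound_of_basic [MeasurableSpace 𝒳] {F : Submodule ℝ (𝒳 → ℝ)}
    (hF : ∀ f ∈ F, Measurable f ∧ MemLp (fun ω => f (X 0 ω)) 2 P) (hf0 : IsTarget P X Y F f0)
    {η : ℝ} (hmargin : ∀ f ∈ Flocal F f0 η,
      c * L2norm P (X 0) (f - f0) ^ 2 ≤ excessRisk P X Y f0 f)
    (hc : 0 < c) (hlam1 : 0 < lam1) (hβs : βs ≠ 0)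
    (hlam2 : lam2 = lam1 * Real.sqrt (supp βs).card / (2 * l2 βs))
    (hφ : 0 < phi P (X 0) ψ lam1 lam2 βs) (hfs : linComb ψ βs ∈ Flocal F f0 η)
    {Δ : ℝ} (hΔ : Δ = 3 / 2 * excessRisk P X Y f0 (linComb ψ βs) +
      9 * lam1 ^ 2 * ((supp βs).card : ℝ) / (phi P (X 0) ψ lam1 lam2 βs ^ 2 * c))
    {b : Fin p → ℝ} (hfb : linComb ψ b ∈ Flocal F f0 η)
    (hbasic : excessRisk P X Y f0 (linComb ψ b) + lam1 * l1 b + lam2 * l2 b ^ 2 ≤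
      Δ + excessRisk P X Y f0 (linComb ψ βs) + lam1 * l1 βs + lam2 * l2 βs ^ 2) :
    excessRisk P X Y f0 (linComb ψ b) + lam1 * l1 (b - βs) +
      lam2 * l2 (restr (supp βs) b - restr (supp βs) βs) ^ 2 ≤ 4 * Δ := by
  have hl2pos := l2_pos hβs
  have hlam2nn : 0 ≤ lam2 := by rw [hlam2]; positivity
  have hridge : 2 * lam2 * l2 βs = lam1 * Real.sqrt (supp βs).card := by
    rw [hlam2]; field_simp
  have hexc : ∀ f ∈ F, 0 ≤ excessRisk P X Y f0 f := fun f hf => sub_nonneg.2 (hf0.2 f hf)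
  -- With `2 λ₂ ‖β*‖₂ = λ₁ √s*`, the two terms of the cone constant coincide: `3(√s* + √s*)`.
  have hcone_eq : coneConst lam1 lam2 (supp βs) βs = 6 * Real.sqrt (supp βs).card := by
    rw [coneConst, restr_supp, hridge]
    field_simp
    ring
  rw [← restr_sub, l1_restr_add_restr_compl (supp βs) (b - βs)]
  refine oracle_arith (φ := phi P (X 0) ψ lam1 lam2 βs) (r := Real.sqrt (supp βs).card) (c := c)
    (ξs := excessRisk P X Y f0 (linComb ψ βs)) (l2_nonneg _) (hexc _ hfs.1) hlam1 hφ hc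
    (Real.sqrt_nonneg _) (l1_restr_le _ _) hlam2nn (add_nonneg (l1_nonneg _) (l1_nonneg _))
    ?_ ?_ (hexc _ hfb.1) fun hD => ?_
  · rw [hΔ, Real.sq_sqrt (Nat.cast_nonneg _)]
  · have e1 := mul_le_mul_of_nonneg_left (l1_sub_le βs b) hlam1.le
    have e2 := mul_le_mul_of_nonneg_left (l2_sq_sub_le βs b) hlam2nn
    have e3 : lam2 * (2 * l2 βs * l2 (restr (supp βs) (b - βs))) =
        lam1 * Real.sqrt (supp βs).card * l2 (restr (supp βs) (b - βs)) := by
      rw [← hridge]; ring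
    rw [mul_sub, mul_sub] at e1 e2
    rw [e3] at e2
    linarith
  · refine ⟨L2norm P (X 0) (linComb ψ (b - βs)), phi_mul_le (by rwa [hcone_eq]), ?_⟩
    have h1 := hmargin _ hfb
    have h2 := hmargin _ hfs
    have h3 := L2norm_sub_sq_le (hF _ (F.sub_mem hfb.1 hf0.1)).2 (hF _ (F.sub_mem hfs.1 hf0.1)).2
    have h4 := mul_le_mul_of_nonneg_left h3 hc.le
    rw [linComb_sub]
    linarith

/-- The calibration of `λ₂` makes the numerator `6 λ₁ √s*`, and `H(v) = v² / (4c)` turns `36 / 4`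
into 9. -/
theorem half_oracleObj_eq (hc : 0 < c) (hlam1 : 0 < lam1) (hβs : βs ≠ 0)
    (hlam2 : lam2 = lam1 * Real.sqrt (supp βs).card / (2 * l2 βs))
    (hφ : 0 < phi P (X 0) ψ lam1 lam2 βs) :
    oracleObj P X Y ψ f0 (quadMargin c) lam1 lam2 βs / 2 =
      3 / 2 * excessRisk P X Y f0 (linComb ψ βs) +
        9 * lam1 ^ 2 * ((supp βs).card : ℝ) / (phi P (X 0) ψ lam1 lam2 βs ^ 2 * c) := by
  have hl2pos := l2_pos hβs
  have hridge : lam2 * l2 βs = lam1 * Real.sqrt (supp βs).card / 2 := by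
    rw [hlam2]; field_simp
  have hnum : 4 * lam1 * Real.sqrt (supp βs).card + 4 * lam2 * l2 βs =
      6 * lam1 * Real.sqrt (supp βs).card := by
    rw [mul_assoc 4 lam2, hridge]; ring
  rw [oracleObj, hnum, convConj_quadMargin hc (by positivity), div_pow, mul_pow,
    Real.sq_sqrt (Nat.cast_nonneg _)]
  field_simp
  ring

/-- Localization: a bound on the `ℓ₁`-distance of a point of the segment that is strictly better
than the a priori bound is inherited by the endpoint. -/
theorem le_of_div_add_mul_le_half {M D : ℝ} (hM : 0 < M) (hD : 0 ≤ D)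
    (h : M / (M + D) * D ≤ M / 2) : D ≤ M := by
  rw [div_mul_eq_mul_div, div_le_iff₀ (by positivity)] at h
  nlinarith

/-- The basic inequality holds along the whole segment by convexity, but noise and margin are
controlled only within `M*` of the oracle. A suitable point of the segment is in range
automatically, and the bound there shows that the estimator is in range too. -/
theorem oracleIneq_of_mem_tau [MeasurableSpace 𝒳] {F : Submodule ℝ (𝒳 → ℝ)}
    (hF : ∀ f ∈ F, Measurable f ∧ MemLp (fun ω => f (X 0 ω)) 2 P) (hf0 : IsTarget P X Y F f0)
    {η : ℝ} (hmargin : ∀ f ∈ Flocal F f0 η,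
      c * L2norm P (X 0) (f - f0) ^ 2 ≤ excessRisk P X Y f0 f)
    (hc : 0 < c) {lam0 : ℝ} (hlam0 : 0 < lam0) (hlam01 : 8 * lam0 ≤ lam1) (hβs : βs ≠ 0)
    (hlam2 : lam2 = lam1 * Real.sqrt (supp βs).card / (2 * l2 βs))
    (hφ : 0 < phi P (X 0) ψ lam1 lam2 βs) (hfs : linComb ψ βs ∈ Flocal F f0 η)
    (hM : 0 < Mstar P X Y ψ f0 (quadMargin c) lam0 lam1 lam2 βs)
    (hloc : ∀ β : Fin p → ℝ, l1 (β - βs) ≤ Mstar P X Y ψ f0 (quadMargin c) lam0 lam1 lam2 βs →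
      linComb ψ β ∈ Flocal F f0 η)
    {Φ : Set (Fin p → ℝ)} (hβsΦ : βs ∈ Φ) {ω : Ω} {bh : Fin p → ℝ}
    (hbh : IsElasticNet X Y ψ Φ lam1 lam2 ω bh)
    (htau : ∀ β : Fin p → ℝ, l1 (β - βs) ≤ Mstar P X Y ψ f0 (quadMargin c) lam0 lam1 lam2 βs →
      |Vn P X Y ψ β ω - Vn P X Y ψ βs ω| ≤
        lam0 * Mstar P X Y ψ f0 (quadMargin c) lam0 lam1 lam2 βs) :
    OracleIneq P X Y ψ f0 c lam1 lam2 βs bh := by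
  have hlam1 : 0 < lam1 := by linarith
  have hlam2nn : 0 ≤ lam2 := by
    have := l2_pos hβs
    rw [hlam2]; positivity
  have hΔ := half_oracleObj_eq (Y := Y) (f0 := f0) hc hlam1 hβs hlam2 hφ
  set Δ := oracleObj P X Y ψ f0 (quadMargin c) lam1 lam2 βs / 2 with hΔdef
  have hMΔ : Mstar P X Y ψ f0 (quadMargin c) lam0 lam1 lam2 βs = Δ / lam0 := rfl
  set M := Mstar P X Y ψ f0 (quadMargin c) lam0 lam1 lam2 βs with hMdef
  have hlM : lam0 * M = Δ := by rw [hMΔ]; field_simp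
  have hbound : ∀ s t : ℝ, 0 ≤ s → 0 ≤ t → s + t = 1 → l1 (s • bh + t • βs - βs) ≤ M →
      excessRisk P X Y f0 (linComb ψ (s • bh + t • βs)) + lam1 * l1 (s • bh + t • βs - βs) +
        lam2 * l2 (restr (supp βs) (s • bh + t • βs) - restr (supp βs) βs) ^ 2 ≤ 4 * Δ := by
    intro s t hs ht hst hle
    refine oracle_bound_of_basic hF hf0 hmargin hc hlam1 hβs hlam2 hφ hfs hΔ (hloc _ hle) ?_
    have h1 := hbh.segment_le hlam1.le hlam2nn hβsΦ hs ht hst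
    have h2 := (abs_le.1 (htau _ hle)).1
    rw [Vn_eq, Vn_eq, hlM] at h2
    simp only [excessRisk]
    linarith
  set D := l1 (bh - βs) with hD
  have hD0 : 0 ≤ D := l1_nonneg _
  have hseg : ∀ s t : ℝ, s + t = 1 → s • bh + t • βs - βs = s • (bh - βs) := by
    intro s t hst
    obtain rfl : t = 1 - s := by linarith
    rw [smul_sub, sub_smul, one_smul]
    abel
  -- The weight `M / (M + D)` puts the point at distance `M D / (M + D) ≤ M`. The bound `4Δ = 4 λ₀
  -- M` together with `λ₁ ≥ 8 λ₀` improves this distance to `M / 2`, which is equivalent to `D ≤ M`.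
  have hDM : D ≤ M := by
    have hs0 : 0 ≤ M / (M + D) := by positivity
    have ht0 : 0 ≤ D / (M + D) := by positivity
    have hst : M / (M + D) + D / (M + D) = 1 := by
      rw [← add_div, div_self (by positivity)]
    have hl : l1 ((M / (M + D)) • bh + (D / (M + D)) • βs - βs) = M / (M + D) * D := by
      rw [hseg _ _ hst, l1_smul, abs_of_nonneg hs0]
    have hle : M / (M + D) * D ≤ M := by
      rw [div_mul_eq_mul_div, div_le_iff₀ (by positivity)]
      nlinarith
    have h := hbound _ _ hs0 ht0 hst (hl.le.trans hle)
    rw [hl] at h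
    have hmem := hloc _ (hl.le.trans hle)
    have hexc : 0 ≤ excessRisk P X Y f0 (linComb ψ ((M / (M + D)) • bh + (D / (M + D)) • βs)) :=
      sub_nonneg.2 (hf0.2 _ hmem.1)
    have hpen : 0 ≤ lam2 * l2 (restr (supp βs) ((M / (M + D)) • bh + (D / (M + D)) • βs) -
        restr (supp βs) βs) ^ 2 := by positivity
    refine le_of_div_add_mul_le_half hM hD0 ?_
    have h8 : 8 * lam0 * (M / (M + D) * D) ≤ lam1 * (M / (M + D) * D) :=
      mul_le_mul_of_nonneg_right hlam01 (mul_nonneg hs0 hD0)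
    refine le_of_mul_le_mul_left ?_ hlam0
    linarith
  have h := hbound 1 0 zero_le_one le_rfl (by norm_num) (by simpa using hDM)
  simp only [one_smul, zero_smul, add_zero] at h
  rw [OracleIneq]
  refine h.trans (le_of_eq ?_)
  rw [hΔ]
  ring

end Oracle
-- Localization radius and noise level.
-- Ensures that moving by `M*` in `ℓ₁` changes `f_β` by at most `η / 2` uniformly; the other half of
-- `η` is spent on `f* - f⁰`. The excess risk term at most doubles the 9 to 18, and the 36 in the
-- smallness condition leaves the factor one half.
theorem Mstar_mul_le {Δ lam0 lam1 L s K η φ c ξ : ℝ} (hφ : 0 < φ) (hc : 0 < c) (hη : 0 < η)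
    (hK : 0 < K) (hlam0 : 0 < lam0) (hlam1 : 0 ≤ lam1) (hlam10 : lam1 ≤ L * lam0) (hs : 0 ≤ s)
    (hΔ : Δ = 3 / 2 * ξ + 9 * lam1 ^ 2 * s / (φ ^ 2 * c))
    (hsmall : 36 * L ^ 2 * lam0 * s * K / (η * φ ^ 2 * c) ≤ 1)
    (hexcess : 3 / 2 * ξ ≤ 9 * lam1 ^ 2 * s / (φ ^ 2 * c)) :
    Δ / lam0 * K ≤ η / 2 := by
  have hpos : 0 < φ ^ 2 * c := by positivity
  rw [div_le_one (by positivity)] at hsmall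
  have h1 : Δ * (φ ^ 2 * c) ≤ 18 * lam1 ^ 2 * s := by
    have : Δ ≤ 18 * lam1 ^ 2 * s / (φ ^ 2 * c) := by
      rw [hΔ]
      refine (add_le_add_left hexcess _).trans (le_of_eq ?_)
      ring
    rwa [le_div_iff₀ hpos] at this
  have h2 : lam1 ^ 2 ≤ L ^ 2 * lam0 ^ 2 := by
    rw [← mul_pow]
    exact pow_le_pow_left₀ hlam1 hlam10 2
  have h3 : 18 * lam1 ^ 2 * s ≤ 18 * (L ^ 2 * lam0 ^ 2) * s := by gcongr
  have h4 : Δ * (φ ^ 2 * c) * K ≤ 18 * (L ^ 2 * lam0 ^ 2) * s * K :=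
    mul_le_mul_of_nonneg_right (h1.trans h3) hK.le
  have h5 := mul_le_mul_of_nonneg_left hsmall hlam0.le
  rw [div_mul_eq_mul_div, div_le_iff₀ hlam0]
  refine le_of_mul_le_mul_right ?_ hpos
  linarith

/-- The choice of the noise level makes the tail bound at most `1 / p`. -/
theorem four_mul_exp_le {n p K M lam0 : ℝ} (hn : 0 < n) (hp : 2 ≤ p) (hK : 0 < K) (hM : 0 < M)
    (hlam0 : lam0 = 2 * (4 * K) * Real.sqrt (Real.log p / n)) :
    4 * p * Real.exp (-(n * (lam0 * M) ^ 2 / (8 * M ^ 2 * K ^ 2))) ≤ 1 / p := by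
  have hlog : 0 ≤ Real.log p := Real.log_nonneg (by linarith)
  have e : n * (lam0 * M) ^ 2 / (8 * M ^ 2 * K ^ 2) = 8 * Real.log p := by
    rw [hlam0, mul_pow, mul_pow _ (Real.sqrt _), Real.sq_sqrt (by positivity)]
    field_simp
    ring
  have hp0 : 0 < p := by linarith
  have hexp : Real.exp (-(8 * Real.log p)) = (p ^ 8)⁻¹ := by
    rw [Real.exp_neg, mul_comm, Real.exp_mul, Real.exp_log hp0]
    norm_cast
  -- The exponent equals `8 log p`, so it remains to see `4 p² ≤ p⁸`, which `p ≥ 2` gives with room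
  -- to spare.
  rw [e, hexp, ← div_eq_mul_inv, div_le_div_iff₀ (by positivity) hp0]
  have h2 : (2 : ℝ) ^ 6 ≤ p ^ 6 := pow_le_pow_left₀ (by norm_num) hp 6
  have h3 : p ^ 2 * 2 ^ 6 ≤ p ^ 2 * p ^ 6 := mul_le_mul_of_nonneg_left h2 (by positivity)
  nlinarith [sq_nonneg p]

end LogitNet

/-! ### The theorem. -/

open LogitNet in
theorem lemma2 (K : ℝ) (hK : 0 < K) :
    -- the constant `d` depends on the bound `K` only
    ∃ d : ℝ, 0 < d ∧
    ∀ {Ω 𝒳 : Type*} [MeasurableSpace Ω] [MeasurableSpace 𝒳]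
      (P : Measure Ω) [IsProbabilityMeasure P]
      (n p : ℕ) [NeZero n]
      -- the i.i.d. sample, with binary responses
      (X : Fin n → Ω → 𝒳) (Y : Fin n → Ω → ℝ)
      (_hX : ∀ i, Measurable (X i)) (_hY : ∀ i, Measurable (Y i))
      (_hbin : ∀ i ω, Y i ω = 0 ∨ Y i ω = 1)
      (_hindep : iIndepFun (fun i ω => (X i ω, Y i ω)) P)
      (_hident : ∀ i, IdentDistrib (fun ω => (X i ω, Y i ω)) (fun ω => (X 0 ω, Y 0 ω)) P P)
      -- the space of functions, a space of square integrable functions of the covariate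
      (F : Submodule ℝ (𝒳 → ℝ))
      (_hF : ∀ f ∈ F, Measurable f ∧ MemLp (fun ω => f (X 0 ω)) 2 P)
      -- the success probability `π(x) = P(Y = 1 | X = x)`, which follows a logit model in `F`
      (π : 𝒳 → ℝ)
      (_hπ : P[Y 0 | MeasurableSpace.comap (X 0) inferInstance] =ᵐ[P] fun ω => π (X 0 ω))
      (_hmodel : ∃ g ∈ F, ∀ x, π x = Real.exp (g x) / (1 + Real.exp (g x)))
      (ε0 : ℝ) (_hε0 : 0 < ε0) (_hε0' : ε0 ≤ 1 / 2)
      (_hπε : ∀ x, ε0 ≤ π x ∧ π x ≤ 1 - ε0)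
      -- the target
      (f0 : 𝒳 → ℝ) (_hf0 : IsTarget P X Y F f0)
      -- the basis functions and the parameter set
      (ψ : Fin p → 𝒳 → ℝ) (_hψF : ∀ j, ψ j ∈ F) (_hψK : ∀ j, SupNormLE (ψ j) K)
      (Φ : Set (Fin p → ℝ)) (_hΦ : Convex ℝ Φ)
      -- the constants
      (η : ℝ) (_hη : 0 < η) (c : ℝ) (_hc : c = marginConst ε0 η)
      (L lam0 lam1 lam2 : ℝ) (_hL : 8 ≤ L) (_hlam0 : 0 < lam0)
      (_hlam01 : 8 * lam0 ≤ lam1) (_hlam10 : lam1 ≤ L * lam0)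
      -- the oracle
      (Γ : Set (Finset (Fin p))) (βs : Fin p → ℝ)
      (_hor : IsOracle P X Y ψ f0 (quadMargin c) lam1 lam2 Γ βs)
      (_hβsΦ : βs ∈ Φ) (_hβs0 : βs ≠ 0)
      (_hlam2 : lam2 = lam1 * Real.sqrt (supp βs).card / (2 * l2 βs))
      -- the elastic net estimator
      (βhat : Ω → Fin p → ℝ) (_hhat : ∀ ω, IsElasticNet X Y ψ Φ lam1 lam2 ω (βhat ω))
      -- smallness, approximation and full rank conditions
      (_hsmall : 36 * L ^ 2 * lam0 * ((supp βs).card : ℝ) * K /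
        (η * phi P (X 0) ψ lam1 lam2 βs ^ 2 * c) ≤ 1)
      (_happrox : SupNormLE (linComb ψ βs - f0) (η / 2))
      (_hexcess : 3 / 2 * excessRisk P X Y f0 (linComb ψ βs) ≤
        9 * lam1 ^ 2 * ((supp βs).card : ℝ) / (phi P (X 0) ψ lam1 lam2 βs ^ 2 * c))
      (_hrank : (gram P (X 0) ψ).rank = p),
      -- (a) the three assumptions, with a quadratic margin, and the inequality on `τ`
      ((MarginCondition (Flocal F f0 η) (excessRisk P X Y f0) (L2norm P (X 0)) f0
          (quadMargin c) ∧
        (linComb ψ βs ∈ Flocal F f0 η ∧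
          ∀ β : Fin p → ℝ,
            l1 (β - βs) ≤ Mstar P X Y ψ f0 (quadMargin c) lam0 lam1 lam2 βs →
              linComb ψ β ∈ Flocal F f0 η) ∧
        0 < phi P (X 0) ψ lam1 lam2 βs) ∧
        ∀ ω ∈ tau P X Y ψ f0 (quadMargin c) lam0 lam1 lam2 βs,
          OracleIneq P X Y ψ f0 c lam1 lam2 βs (βhat ω)) ∧
      -- (b) the probability of `τ` and of the inequality
      (2 ≤ p → Real.log p ≤ n →
        (1 / (n : ℝ)) * (∑ i, (⨆ j, (∫ ω, ψ j (X i ω) ^ 2 ∂P))) ≤ 1 →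
        lam0 = 2 * d * Real.sqrt (Real.log p / n) →
          1 - 1 / (p : ℝ) ≤ P.real (tau P X Y ψ f0 (quadMargin c) lam0 lam1 lam2 βs) ∧
          1 - 1 / (p : ℝ) ≤ P.real {ω | OracleIneq P X Y ψ f0 c lam1 lam2 βs (βhat ω)}) := by
  -- With `d = 4K` the squared noise level is `64 K² log p / n`, large enough for the tail exponent
  -- to beat the factor `4p`.
  refine ⟨4 * K, by positivity, ?_⟩
  intro Ω 𝒳 _ _ P _ n p _ X Y hX hY hbin hindep hident F hF π hπ hmodel ε0 hε0 _ hπε f0 hf0 ψ hψF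
    hψK Φ _ η hη c hc L lam0 lam1 lam2 _ hlam0 hlam01 hlam10 Γ βs _ hβsΦ hβs hlam2 βhat hhat
    hsmall happrox hexcess hrank
  have hlam1 : 0 < lam1 := by linarith
  have hlam2nn : 0 ≤ lam2 := by
    have := l2_pos hβs
    rw [hlam2]; positivity
  have hc0 : 0 < c := hc ▸ marginConst_pos hε0
  have hψ : ∀ j, Measurable (ψ j) := fun j => (hF _ (hψF j)).1
  have hφ := phi_pos (P := P) (hX 0) hψ hψK hrank hlam1.le hlam2nn hβs
  have hs : (0 : ℝ) < (supp βs).card := Nat.cast_pos.2 (supp_card_pos hβs)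
  have hmargin : ∀ f ∈ Flocal F f0 η, c * L2norm P (X 0) (f - f0) ^ 2 ≤ excessRisk P X Y f0 f :=
    fun f hf => hc ▸ margin_of_logit (hX 0) (hY 0) (hbin 0) hident hF hπ hmodel hε0 hπε hf0 hf
  have hfs : linComb ψ βs ∈ Flocal F f0 η :=
    ⟨linComb_mem hψF βs, fun x => (happrox x).trans (by linarith)⟩
  have hΔ := half_oracleObj_eq (Y := Y) (f0 := f0) hc0 hlam1 hβs hlam2 hφ
  have hMK : Mstar P X Y ψ f0 (quadMargin c) lam0 lam1 lam2 βs * K ≤ η / 2 :=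
    Mstar_mul_le hφ hc0 hη hK hlam0 hlam1.le hlam10 hs.le hΔ hsmall hexcess
  have hM : 0 < Mstar P X Y ψ f0 (quadMargin c) lam0 lam1 lam2 βs := by
    have hξ : 0 ≤ excessRisk P X Y f0 (linComb ψ βs) := sub_nonneg.2 (hf0.2 _ hfs.1)
    rw [Mstar, hΔ]
    positivity
  have hloc : ∀ β : Fin p → ℝ,
      l1 (β - βs) ≤ Mstar P X Y ψ f0 (quadMargin c) lam0 lam1 lam2 βs →
        linComb ψ β ∈ Flocal F f0 η := by
    refine fun β hβ => ⟨linComb_mem hψF β, fun x => ?_⟩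
    have h1 := abs_linComb_le hψK (β - βs) x
    have h2 := mul_le_mul_of_nonneg_right hβ hK.le
    have h3 := abs_add_le ((linComb ψ β - linComb ψ βs) x) ((linComb ψ βs - f0) x)
    rw [linComb_sub] at h1
    rw [← Pi.add_apply, sub_add_sub_cancel] at h3
    linarith [happrox x]
  have horacle : ∀ ω ∈ tau P X Y ψ f0 (quadMargin c) lam0 lam1 lam2 βs,
      OracleIneq P X Y ψ f0 c lam1 lam2 βs (βhat ω) := fun ω hω =>
    oracleIneq_of_mem_tau hF hf0 hmargin hc0 hlam0 hlam01 hβs hlam2 hφ hfs hM hloc hβsΦ (hhat ω)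
      fun β hβ => (Vn_sub_Vn_le_ZM hX hY hbin hψ hK.le hψK hβ ω).trans hω
  refine ⟨⟨⟨⟨strictConvexOn_quadMargin hc0, by simp [quadMargin], hmargin⟩, ⟨hfs, hloc⟩, hφ⟩,
    horacle⟩, fun hp _ _ hd => ?_⟩
  have hp' : (2 : ℝ) ≤ p := by exact_mod_cast hp
  have : NeZero p := ⟨by omega⟩
  have htail := (tail_bound_ZM (P := P) hX hY hbin hindep hident hψ hK hψK (βs := βs) hM
    (t := lam0 * Mstar P X Y ψ f0 (quadMargin c) lam0 lam1 lam2 βs) (by positivity)).trans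
    (four_mul_exp_le (Nat.cast_pos.2 (NeZero.pos n)) hp' hK hM hd)
  have htau : 1 - 1 / (p : ℝ) ≤ P.real (tau P X Y ψ f0 (quadMargin c) lam0 lam1 lam2 βs) := by
    have hcompl := measureReal_union_le (μ := P) (tau P X Y ψ f0 (quadMargin c) lam0 lam1 lam2 βs)
      (tau P X Y ψ f0 (quadMargin c) lam0 lam1 lam2 βs)ᶜ
    rw [Set.union_compl_self, probReal_univ] at hcompl
    -- The complement of the event is exactly a strict exceedance by the local supremum, the form
    -- treated by the tail bound.
    have hset : (tau P X Y ψ f0 (quadMargin c) lam0 lam1 lam2 βs)ᶜ =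
        {ω | lam0 * Mstar P X Y ψ f0 (quadMargin c) lam0 lam1 lam2 βs <
          ZM P X Y ψ βs (Mstar P X Y ψ f0 (quadMargin c) lam0 lam1 lam2 βs) ω} := by
      ext ω
      simp [tau]
    rw [hset] at hcompl
    linarith
  exact ⟨htau, htau.trans (measureReal_mono horacle)⟩
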